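/- **Setting.** Let $m\ge 0$ and let $\mathfrak h=L^2(\mathbb R^3,\mathbb C^4)$, with inner products antilinear in the first argument. Let $h_D=-i\sum_{a=1}^3\gamma^0\gamma^a\partial_a+m\gamma^0$ be the free Dirac operator (with $\gamma^0,\dots,\gamma^3$ the Dirac matrices in the standard representation), let $\mathfrak h_+$ and $\mathfrak h_-$ be its positive and negative spectral subspaces, with orthogonal projections $P_\pm$, and let $Cf=i\gamma^2\overline f$ be the charge conjugation. Let $\mathscr H=\mathcal F_-(\mathfrak h_+)\otimes\mathcal F_-(C\mathfrak h_-)=\bigoplus_{n,k\ge 0}\mathfrak h_+^{\wedge n}\otimes(C\mathfrak h_-)^{\wedge k}$ be the Hilbert space of the Dirac field, where $\mathcal F_-$ is the fermionic Fock space, with vacuum vector $\Omega$. For $f\in\mathfrak h$ let $b^*(f)$ and $b(f)$ be the operators on $\mathscr H$ that create and annihilate a particle in the state $P_+f$, and let $c^*(f)$ and $c(f)$ be those that create and annihilate an antiparticle in the state $CP_-f$, with a factor $(-1)^n$ on the sectors with $n$ particles. Put $\Psi(f)=b(f)+c^*(f)$, $\Psi^*(f)=b^*(f)+c(f)$, and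 let $$:\!\Psi^*(f)\Psi(f)\!:\ =\ b^*(f)b(f)+c(f)b(f)+b^*(f)c^*(f)-c^*(f)c(f)$$ be the normally ordered product. Let $F\subset\mathscr H$ be the set of finite complex-linear combinations of vectors $\Psi^*(g_1)\cdots\Psi^*(g_k)\Psi(h_1)\cdots\Psi(h_l)\,\Omega$ with $k,l\ge 0$ and $g_i,h_j\in\mathfrak h$ (so $\Omega\in F$). **Theorem.** Let $0\ne\psi\in F$, let $x\in\mathbb R^3$ and let $A=x+[-\pi,\pi]^3$. Then there is an orthonormal basis $(f_j)_{j\in\mathbb N}$ of the space $L^2(A,\mathbb C^4)$ of those functions in $\mathfrak h$ that vanish outside $A$, such that the truncated charge operators $Q^J_{A,(f_j)}=\sum_{j=1}^J :\!\Psi^*(f_j)\Psi(f_j)\!:$ satisfy $$\lim_{J\to\infty}\bigl\|Q^J_{A,(f_j)}\,\psi\bigr\|^2=\infty .$$ In particular $\psi$ is not in the domain of the charge operator $Q_A=\sum_{j=1}^\infty :\!\Psi^*(f_j)\Psi(f_j)\!:$ of that basis, meaning that $Q^J_{A,(f_j)}\psi$ does not converge in $\mathscr H$ as $J\to\infty$.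 -/

import Mathlib

open MeasureTheory Filter Topology
open scoped TensorProduct FourierTransform InnerProductSpace

noncomputable section

/-! ### The fermionic Fock space over a complex inner product space

The algebraic direct sum of the antisymmetric powers of `E` is the exterior algebra of `E`.  It
carries the inner product for which different degrees are orthogonal and
`⟪f₁ ∧ ⋯ ∧ fₙ, g₁ ∧ ⋯ ∧ gₙ⟫ = det ⟪fᵢ, gⱼ⟫`, that is, the inner product of the antisymmetric
tensors `(n!)^(-1/2) ∑_σ sgn σ • f_σ(1) ⊗ ⋯ ⊗ f_σ(n)`. -/

namespace Fermion

variable {E : Type*} [NormedAddCommGroup E] [InnerProductSpace ℂ E]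

/-- The algebraic Fock space over `E`, the algebraic direct sum of the antisymmetric powers. -/
abbrev Alg (E : Type*) [NormedAddCommGroup E] [InnerProductSpace ℂ E] : Type _ :=
  ExteriorAlgebra ℂ E

/-- Creation of one particle in the state `f`: `u ↦ f ∧ u`. -/
def create (f : E) : Alg E →ₗ[ℂ] Alg E :=
  LinearMap.mulLeft ℂ (ExteriorAlgebra.ι ℂ f)

/-- Annihilation of one particle in the state `f`: the contraction
`g₁ ∧ ⋯ ∧ gₙ ↦ ∑ⱼ (-1)^(j+1) ⟪f, gⱼ⟫ • g₁ ∧ ⋯ (no gⱼ) ⋯ ∧ gₙ`. -/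
def annihilate (f : E) : Alg E →ₗ[ℂ] Alg E :=
  CliffordAlgebra.contractLeft (Q := (0 : QuadraticForm ℂ E)) (innerₛₗ ℂ f)

/-- The parity operator `(-1)^N`, with `N` the particle number. -/
def parity : Alg E →ₗ[ℂ] Alg E :=
  (CliffordAlgebra.involute (Q := (0 : QuadraticForm ℂ E))).toLinearMap

theorem fock_induction {P : Alg E → Prop}
    (scalar : ∀ r : ℂ, P (algebraMap ℂ _ r)) (add : ∀ u v, P u → P v → P (u + v))
    (mul : ∀ (f : E) u, P u → P (create f u)) (u : Alg E) : P u :=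
  CliffordAlgebra.left_induction (Q := (0 : QuadraticForm ℂ E)) scalar add
    (fun u f h => mul f u h) u

@[simp] theorem annihilate_algebraMap (f : E) (r : ℂ) :
    annihilate f (algebraMap ℂ _ r) = 0 :=
  CliffordAlgebra.contractLeft_algebraMap _ _ _

/-- The canonical anticommutation relation. -/
theorem annihilate_create (f g : E) (u : Alg E) :
    annihilate f (create g u) = ⟪f, g⟫_ℂ • u - create g (annihilate f u) :=
  CliffordAlgebra.contractLeft_ι_mul _ _ _

theorem create_create_self (f : E) (u : Alg E) : create f (create f u) = 0 := by
  simp [create, ← mul_assoc]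

theorem annihilate_annihilate_self (f : E) (u : Alg E) :
    annihilate f (annihilate f u) = 0 :=
  CliffordAlgebra.contractLeft_contractLeft _ _

theorem create_create (f g : E) (u : Alg E) :
    create f (create g u) = - create g (create f u) := by
  have h := ExteriorAlgebra.ι_add_mul_swap (R := ℂ) f g
  have h2 := congrArg (· * u) h
  simp only [add_mul, zero_mul, mul_assoc] at h2
  exact eq_neg_of_add_eq_zero_left h2

@[simp] theorem parity_algebraMap (r : ℂ) :
    parity (algebraMap ℂ (Alg E) r) = algebraMap ℂ _ r :=
  AlgHom.commutes _ _

theorem parity_create (f : E) (u : Alg E) :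
    parity (create f u) = - create f (parity u) := by
  have := CliffordAlgebra.involute_ι (Q := (0 : QuadraticForm ℂ E)) f
  simp only [parity, create, AlgHom.toLinearMap_apply, LinearMap.mulLeft_apply, map_mul]
  erw [this]
  exact neg_mul _ _

theorem annihilate_parity (f : E) (u : Alg E) :
    annihilate f (parity u) = - parity (annihilate f u) := by
  induction u using fock_induction with
  | scalar r => simp
  | add u v hu hv => simp only [map_add, hu, hv, neg_add]
  | mul g u hu =>
    simp only [parity_create, annihilate_create, map_neg, map_sub, map_smul, hu]

/-- The ring of operators on the exterior algebra with reversed multiplication and with the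
conjugate complex scalar multiplication; the target of the map taking `f₁ ∧ ⋯ ∧ fₙ` to
`a(fₙ) ⋯ a(f₁)`, which is antilinear. -/
def ConjOp (E : Type*) [NormedAddCommGroup E] [InnerProductSpace ℂ E] : Type _ :=
  (Module.End ℂ (Alg E))ᵐᵒᵖ

instance : Ring (ConjOp E) :=
  inferInstanceAs (Ring (Module.End ℂ (Alg E))ᵐᵒᵖ)

instance : Algebra ℂ (ConjOp E) :=
  Algebra.compHom (Module.End ℂ (Alg E))ᵐᵒᵖ (starRingEnd ℂ)

/-- `f ↦ a(f)` as a linear map into the conjugate operator algebra. -/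
def annihilateConj : E →ₗ[ℂ] ConjOp E where
  toFun f := MulOpposite.op (annihilate f)
  map_add' f g := by
    simp only [annihilate, map_add]
    rfl
  map_smul' c f := by
    simp only [annihilate, map_smulₛₗ]
    rfl

/-- The operator `a(fₙ) ⋯ a(f₁)` attached to `f₁ ∧ ⋯ ∧ fₙ`, extended antilinearly. -/
def adjointOp (u : Alg E) : Module.End ℂ (Alg E) :=
  MulOpposite.unop (show (Module.End ℂ (Alg E))ᵐᵒᵖ from
    ExteriorAlgebra.lift ℂ ⟨annihilateConj, fun f =>
      MulOpposite.unop_injective (LinearMap.ext (annihilate_annihilate_self f))⟩ u)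

/-- The inner product of the Fock space: `⟪f₁ ∧ ⋯ ∧ fₙ, v⟫` is the scalar part of
`a(fₙ) ⋯ a(f₁) v`. -/
def fockInner (u v : Alg E) : ℂ :=
  ExteriorAlgebra.algebraMapInv (adjointOp u v)

theorem adjointOp_add (u v : Alg E) :
    adjointOp (u + v) = adjointOp u + adjointOp v := by
  unfold adjointOp; rw [map_add]; rfl

theorem adjointOp_smul (c : ℂ) (u : Alg E) :
    adjointOp (c • u) = (starRingEnd ℂ c) • adjointOp u := by
  unfold adjointOp; rw [map_smul]; rfl

theorem adjointOp_algebraMap (r : ℂ) (v : Alg E) :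
    adjointOp (algebraMap ℂ _ r) v = (starRingEnd ℂ r) • v := by
  unfold adjointOp; rw [AlgHom.commutes]; rfl

theorem adjointOp_create (f : E) (u v : Alg E) :
    adjointOp (create f u) v = adjointOp u (annihilate f v) := by
  have h := ExteriorAlgebra.lift_ι_apply ℂ (annihilateConj (E := E)) (fun f =>
      MulOpposite.unop_injective (LinearMap.ext (annihilate_annihilate_self f))) f
  simp only [adjointOp, create, LinearMap.mulLeft_apply, map_mul]
  rw [h]
  rfl

theorem fockInner_add_left (u v w : Alg E) :
    fockInner (u + v) w = fockInner u w + fockInner v w := by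
  simp [fockInner, adjointOp_add]

theorem fockInner_add_right (u v w : Alg E) :
    fockInner u (v + w) = fockInner u v + fockInner u w := by
  simp [fockInner]

theorem fockInner_sub_right (u v w : Alg E) :
    fockInner u (v - w) = fockInner u v - fockInner u w := by
  simp [fockInner]

theorem fockInner_smul_left (c : ℂ) (u v : Alg E) :
    fockInner (c • u) v = starRingEnd ℂ c * fockInner u v := by
  simp [fockInner, adjointOp_smul]

theorem fockInner_smul_right (c : ℂ) (u v : Alg E) :
    fockInner u (c • v) = c * fockInner u v := by
  simp [fockInner]

theorem fockInner_neg_left (u v : Alg E) :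
    fockInner (-u) v = - fockInner u v := by
  have := fockInner_smul_left (-1) u v
  simpa using this

theorem fockInner_neg_right (u v : Alg E) :
    fockInner u (-v) = - fockInner u v := by
  simp [fockInner]

theorem fockInner_sub_left (u v w : Alg E) :
    fockInner (u - v) w = fockInner u w - fockInner v w := by
  rw [sub_eq_add_neg, fockInner_add_left, fockInner_neg_left, sub_eq_add_neg]

theorem fockInner_algebraMap_left (r : ℂ) (v : Alg E) :
    fockInner (algebraMap ℂ _ r) v = starRingEnd ℂ r * ExteriorAlgebra.algebraMapInv v := by
  simp [fockInner, adjointOp_algebraMap]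

/-- Creation is adjoint to annihilation. -/
theorem fockInner_create_left (f : E) (u v : Alg E) :
    fockInner (create f u) v = fockInner u (annihilate f v) := by
  simp [fockInner, adjointOp_create]

theorem fockInner_annihilate_left (f : E) (u v : Alg E) :
    fockInner (annihilate f u) v = fockInner u (create f v) := by
  induction u using fock_induction generalizing v with
  | scalar r =>
    have h : ExteriorAlgebra.algebraMapInv (create f v) = (0 : ℂ) := by
      simp [create, ExteriorAlgebra.algebraMapInv]
    have h0 : fockInner (0 : Alg E) v = 0 := by
      simpa using fockInner_smul_left 0 0 v
    rw [annihilate_algebraMap, fockInner_algebraMap_left, h, h0, mul_zero]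
  | add u u' hu hu' => simp only [map_add, fockInner_add_left, hu, hu']
  | mul g u hu =>
    rw [annihilate_create, fockInner_sub_left, fockInner_smul_left, fockInner_create_left,
      fockInner_create_left, hu, annihilate_create, fockInner_sub_right, fockInner_smul_right,
      inner_conj_symm]

theorem fockInner_conj_symm (u v : Alg E) :
    starRingEnd ℂ (fockInner v u) = fockInner u v := by
  induction u using fock_induction generalizing v with
  | scalar r =>
    induction v using fock_induction with
    | scalar s =>
      simp [fockInner_algebraMap_left, ExteriorAlgebra.algebraMapInv, mul_comm]
    | add v w hv hw => rw [fockInner_add_left, fockInner_add_right, map_add, hv, hw]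
    | mul g v hv =>
      rw [fockInner_create_left, ← fockInner_annihilate_left, annihilate_algebraMap]
      have h0 : fockInner (0 : Alg E) v = 0 := by
        simpa using fockInner_smul_left 0 0 v
      rw [h0]
      simp [fockInner]
  | add u u' hu hu' => rw [fockInner_add_left, fockInner_add_right, map_add, hu, hu']
  | mul g u hu => rw [fockInner_create_left, ← fockInner_annihilate_left, hu]

/-- The exterior algebra of the subspace `V`, inside the exterior algebra of `E`. -/
def subFock (V : Submodule ℂ E) : Subalgebra ℂ (Alg E) :=
  Algebra.adjoin ℂ (ExteriorAlgebra.ι ℂ '' (V : Set E))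

theorem subFock_mono {V W : Submodule ℂ E} (h : V ≤ W) : subFock V ≤ subFock W :=
  Algebra.adjoin_mono (Set.image_mono h)

theorem exists_mem_subFock (u : Alg E) :
    ∃ V : Submodule ℂ E, FiniteDimensional ℂ V ∧ u ∈ subFock V := by
  induction u using fock_induction with
  | scalar r => exact ⟨⊥, inferInstance, Subalgebra.algebraMap_mem _ r⟩
  | add u v hu hv =>
    obtain ⟨V, hV, hu⟩ := hu
    obtain ⟨W, hW, hv⟩ := hv
    exact ⟨V ⊔ W, inferInstance,
      add_mem (subFock_mono le_sup_left hu) (subFock_mono le_sup_right hv)⟩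
  | mul f u hu =>
    obtain ⟨V, hV, hu⟩ := hu
    refine ⟨V ⊔ Submodule.span ℂ {f}, inferInstance, mul_mem ?_ (subFock_mono le_sup_left hu)⟩
    exact Algebra.subset_adjoin
      ⟨f, Submodule.mem_sup_right (Submodule.mem_span_singleton_self f), rfl⟩

/-- The span of the wedge products of the members of a list. -/
def listFock : List E → Submodule ℂ (Alg E)
  | [] => Submodule.span ℂ {1}
  | e :: l => listFock l ⊔ (listFock l).map (create e)

theorem one_mem_listFock (l : List E) : (1 : Alg E) ∈ listFock l := by
  induction l with
  | nil => exact Submodule.mem_span_singleton_self 1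
  | cons e l ih => exact Submodule.mem_sup_left ih

theorem create_mem_listFock (l : List E) {e : E} (he : e ∈ l) {u : Alg E}
    (hu : u ∈ listFock l) : create e u ∈ listFock l := by
  induction l generalizing u with
  | nil => simp at he
  | cons d l ih =>
    obtain ⟨u₀, h₀, w, ⟨u₁, h₁, rfl⟩, rfl⟩ := Submodule.mem_sup.mp hu
    rw [map_add]
    rcases List.mem_cons.mp he with rfl | he
    · rw [create_create_self, add_zero]
      exact Submodule.mem_sup_right ⟨u₀, h₀, rfl⟩
    · refine add_mem (Submodule.mem_sup_left (ih he h₀)) (Submodule.mem_sup_right ?_)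
      rw [create_create]
      exact neg_mem ⟨_, ih he h₁, rfl⟩

theorem annihilate_listFock (l : List E) {e : E} (he : ∀ d ∈ l, ⟪e, d⟫_ℂ = 0)
    {u : Alg E} (hu : u ∈ listFock l) : annihilate e u = 0 := by
  induction l generalizing u with
  | nil =>
    obtain ⟨c, rfl⟩ := Submodule.mem_span_singleton.mp hu
    rw [← Algebra.algebraMap_eq_smul_one, annihilate_algebraMap]
  | cons d l ih =>
    obtain ⟨u₀, h₀, w, ⟨u₁, h₁, rfl⟩, rfl⟩ := Submodule.mem_sup.mp hu
    have ih' := fun u => @ih (fun d hd => he d (List.mem_cons_of_mem _ hd)) u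
    rw [map_add, ih' _ h₀, annihilate_create, ih' _ h₁, he d List.mem_cons_self]
    simp

theorem fockInner_self_listFock (l : List E) (h1 : ∀ e ∈ l, ⟪e, e⟫_ℂ = 1)
    (h2 : l.Pairwise fun d e => ⟪d, e⟫_ℂ = 0) {u : Alg E} (hu : u ∈ listFock l) :
    0 ≤ (fockInner u u).re ∧ (fockInner u u = 0 → u = 0) := by
  induction l generalizing u with
  | nil =>
    obtain ⟨c, rfl⟩ := Submodule.mem_span_singleton.mp hu
    rw [← Algebra.algebraMap_eq_smul_one, fockInner_algebraMap_left]
    have h : starRingEnd ℂ c * ExteriorAlgebra.algebraMapInv (algebraMap ℂ (Alg E) c)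
        = ((‖c‖ ^ 2 : ℝ) : ℂ) := by
      rw [ExteriorAlgebra.algebraMap_leftInverse]
      simpa using Complex.conj_mul' c
    rw [h]
    refine ⟨by rw [Complex.ofReal_re]; positivity, fun h => ?_⟩
    have : c = 0 := by simpa using h
    rw [this, map_zero]
  | cons e l ih =>
    obtain ⟨u₀, h₀, w, ⟨u₁, h₁, rfl⟩, rfl⟩ := Submodule.mem_sup.mp hu
    have hl := List.pairwise_cons.mp h2
    have ih' := fun u => @ih (fun d hd => h1 d (List.mem_cons_of_mem _ hd)) hl.2 u
    have a₀ := annihilate_listFock l hl.1 h₀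
    have a₁ := annihilate_listFock l hl.1 h₁
    have z (x : Alg E) : fockInner x 0 = 0 := by simp [fockInner]
    have key : fockInner (u₀ + create e u₁) (u₀ + create e u₁)
        = fockInner u₀ u₀ + fockInner u₁ u₁ := by
      have c : fockInner u₀ (create e u₁) = 0 := by
        rw [← fockInner_conj_symm, fockInner_create_left, a₀, z, map_zero]
      rw [fockInner_add_left, fockInner_add_right, fockInner_create_left, map_add, a₀,
        annihilate_create, a₁, map_zero, h1 e List.mem_cons_self, c]
      simp
    have r (x : Alg E) : fockInner x x = ((fockInner x x).re : ℂ) :=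
      (Complex.conj_eq_iff_re.mp (fockInner_conj_symm x x)).symm
    obtain ⟨p₀, q₀⟩ := ih' u₀ h₀
    obtain ⟨p₁, q₁⟩ := ih' u₁ h₁
    rw [key]
    refine ⟨by simpa using add_nonneg p₀ p₁, fun h => ?_⟩
    have hre : (fockInner u₀ u₀).re + (fockInner u₁ u₁).re = 0 := by
      simpa using congrArg Complex.re h
    rw [q₀ (by rw [r, (by linarith : (fockInner u₀ u₀).re = 0), Complex.ofReal_zero]),
      q₁ (by rw [r, (by linarith : (fockInner u₁ u₁).re = 0), Complex.ofReal_zero])]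
    simp

theorem fockInner_self (u : Alg E) :
    0 ≤ (fockInner u u).re ∧ (fockInner u u = 0 → u = 0) := by
  obtain ⟨V, hV, hu⟩ := exists_mem_subFock u
  let b := stdOrthonormalBasis ℂ V
  let l : List E := List.ofFn fun i => (b i : E)
  have ho : ∀ i j, ⟪(b i : E), (b j : E)⟫_ℂ = if i = j then 1 else 0 := fun i j =>
    orthonormal_iff_ite.mp b.orthonormal i j
  refine fockInner_self_listFock l ?_ ?_ (u := u) ?_
  · intro e he
    obtain ⟨i, rfl⟩ := List.mem_ofFn.mp he
    simpa using ho i i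
  · rw [List.pairwise_ofFn]
    intro i j hij
    simpa [hij.ne] using ho i j
  · have hV' : ∀ v ∈ V, ∀ w ∈ listFock l, create v w ∈ listFock l := by
      intro v hv w hw
      have hs : v = ∑ i, b.repr ⟨v, hv⟩ i • (b i : E) := by
        have := congrArg (Subtype.val) (b.sum_repr ⟨v, hv⟩)
        simpa using this.symm
      have : create v w = ∑ i, b.repr ⟨v, hv⟩ i • create (b i : E) w := by
        conv_lhs => rw [hs]
        simp [create, Finset.sum_mul]
      rw [this]
      exact Submodule.sum_mem _ fun i _ => Submodule.smul_mem _ _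
        (create_mem_listFock l (List.mem_ofFn.mpr ⟨i, rfl⟩) hw)
    have hmul : ∀ x ∈ subFock V, ∀ w ∈ listFock l, x * w ∈ listFock l := by
      intro x hx
      induction hx using Algebra.adjoin_induction with
      | mem x hx =>
        obtain ⟨v, hv, rfl⟩ := hx
        exact hV' v hv
      | algebraMap r =>
        intro w hw
        rw [← Algebra.smul_def]
        exact Submodule.smul_mem _ _ hw
      | add x y _ _ hx hy =>
        intro w hw
        rw [add_mul]
        exact add_mem (hx w hw) (hy w hw)
      | mul x y _ _ hx hy =>
        intro w hw
        rw [mul_assoc]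
        exact hx _ (hy w hw)
    simpa using hmul u hu 1 (one_mem_listFock l)

/-- The algebraic Fock space is an inner product space. -/
@[reducible] def fockCore : InnerProductSpace.Core ℂ (Alg E) where
  inner := fockInner
  conj_inner_symm := fockInner_conj_symm
  re_inner_nonneg u := (fockInner_self u).1
  add_left := fockInner_add_left
  smul_left u v c := fockInner_smul_left c u v
  definite u := (fockInner_self u).2

instance : NormedAddCommGroup (Alg E) :=
  fockCore.toNormedAddCommGroup

instance : InnerProductSpace ℂ (Alg E) :=
  InnerProductSpace.ofCore _

theorem inner_create_left (f : E) (u v : Alg E) :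
    ⟪create f u, v⟫_ℂ = ⟪u, annihilate f v⟫_ℂ :=
  fockInner_create_left f u v

theorem norm_sq_create_add (f : E) (u : Alg E) :
    ‖create f u‖ ^ 2 + ‖annihilate f u‖ ^ 2 = (‖f‖ * ‖u‖) ^ 2 := by
  have h1 : ⟪create f u, create f u⟫_ℂ
      = ⟪f, f⟫_ℂ * ⟪u, u⟫_ℂ - ⟪annihilate f u, annihilate f u⟫_ℂ := by
    rw [inner_create_left, annihilate_create, inner_sub_right, inner_smul_right]
    congr 1
    exact (fockInner_annihilate_left f u _).symm
  simp only [inner_self_eq_norm_sq_to_K] at h1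
  have h2 : ‖create f u‖ ^ 2 = ‖f‖ ^ 2 * ‖u‖ ^ 2 - ‖annihilate f u‖ ^ 2 := by
    exact_mod_cast h1
  rw [h2]; ring

/-- Creation as a bounded operator. -/
def createL (f : E) : Alg E →L[ℂ] Alg E :=
  (create f).mkContinuous ‖f‖ fun u => by
    have := norm_sq_create_add f u
    exact abs_le_of_sq_le_sq' (by nlinarith [sq_nonneg ‖annihilate f u‖]) (by positivity) |>.2

/-- Annihilation as a bounded operator. -/
def annihilateL (f : E) : Alg E →L[ℂ] Alg E :=
  (annihilate f).mkContinuous ‖f‖ fun u => by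
    have := norm_sq_create_add f u
    exact abs_le_of_sq_le_sq' (by nlinarith [sq_nonneg ‖create f u‖]) (by positivity) |>.2

theorem inner_parity (u v : Alg E) : ⟪parity u, parity v⟫_ℂ = ⟪u, v⟫_ℂ := by
  change fockInner _ _ = fockInner _ _
  induction u using fock_induction generalizing v with
  | scalar r =>
    rw [parity_algebraMap, fockInner_algebraMap_left, fockInner_algebraMap_left]
    congr 1
    induction v using fock_induction with
    | scalar s => simp
    | add v w hv hw => simp only [map_add, hv, hw]
    | mul g v _ =>
      rw [parity_create]
      simp [create, ExteriorAlgebra.algebraMapInv]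
  | add u u' hu hu' => simp only [map_add, fockInner_add_left, hu, hu']
  | mul g u hu =>
    rw [parity_create, fockInner_neg_left, fockInner_create_left, annihilate_parity,
      fockInner_neg_right, neg_neg, hu, fockInner_create_left]

/-- The parity operator as a bounded operator. -/
def parityL : Alg E →L[ℂ] Alg E :=
  parity.mkContinuous 1 fun u => by
    have h := inner_parity u u
    simp only [inner_self_eq_norm_sq_to_K] at h
    have h2 : ‖parity u‖ ^ 2 = ‖u‖ ^ 2 := by exact_mod_cast h
    rw [one_mul]
    exact (abs_le_of_sq_le_sq' h2.le (norm_nonneg _)).2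

/-! ### Two species of fermions -/

section TwoSpecies

variable (E F : Type*) [NormedAddCommGroup E] [InnerProductSpace ℂ E]
  [NormedAddCommGroup F] [InnerProductSpace ℂ F]

/-- The algebraic Fock space of two species, the tensor product of the algebraic Fock spaces over
`E` (first species) and over `F` (second species). -/
abbrev Alg₂ : Type _ := Alg E ⊗[ℂ] Alg F

/-- The Hilbert space of two species, the Hilbert space tensor product of the fermionic Fock
spaces over `E` and over `F`, that is, the Hilbert space direct sum of all `E^(∧n) ⊗ F^(∧m)`. -/
abbrev Fock₂ : Type _ := UniformSpace.Completion (Alg₂ E F)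

/-- The state without particles. -/
def vacuum₂ : Fock₂ E F := ((1 ⊗ₜ[ℂ] 1 : Alg₂ E F) : Fock₂ E F)

variable {E F}

/-- The bounded operator on the Fock space that extends `S ⊗ T`. -/
def tensorOp (S : Alg E →L[ℂ] Alg E) (T : Alg F →L[ℂ] Alg F) : Fock₂ E F →L[ℂ] Fock₂ E F :=
  (TensorProduct.mapL S T).completion

/-- Creation of a particle of the first species. -/
def createFst (e : E) : Fock₂ E F →L[ℂ] Fock₂ E F :=
  tensorOp (createL e) (ContinuousLinearMap.id ℂ _)

/-- Annihilation of a particle of the first species. -/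
def annihilateFst (e : E) : Fock₂ E F →L[ℂ] Fock₂ E F :=
  tensorOp (annihilateL e) (ContinuousLinearMap.id ℂ _)

/-- Creation of a particle of the second species, with the sign `(-1)ⁿ` on states with `n`
particles of the first species. -/
def createSnd (e : F) : Fock₂ E F →L[ℂ] Fock₂ E F := tensorOp parityL (createL e)

/-- Annihilation of a particle of the second species, with the sign `(-1)ⁿ` on states with `n`
particles of the first species. -/
def annihilateSnd (e : F) : Fock₂ E F →L[ℂ] Fock₂ E F := tensorOp parityL (annihilateL e)

end TwoSpecies

end Fermion

/-! ### The Dirac field -/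

namespace DiracField

/-- Physical space `ℝ³`. -/
abbrev Space : Type := EuclideanSpace ℝ (Fin 3)

/-- Spin space `ℂ⁴`. -/
abbrev Spin : Type := EuclideanSpace ℂ (Fin 4)

/-- The one-particle Hilbert space `L²(ℝ³, ℂ⁴)`. -/
abbrev OneParticle : Type := Lp Spin 2 (volume : Measure Space)

/-- The Dirac matrix `γ⁰` (standard representation). -/
def gamma0 : Matrix (Fin 4) (Fin 4) ℂ :=
  !![1, 0, 0, 0; 0, 1, 0, 0; 0, 0, -1, 0; 0, 0, 0, -1]

/-- The Dirac matrices `γ¹, γ², γ³` (standard representation). -/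
def gamma : Fin 3 → Matrix (Fin 4) (Fin 4) ℂ :=
  ![!![0, 0, 0, 1; 0, 0, 1, 0; 0, -1, 0, 0; -1, 0, 0, 0],
    !![0, 0, 0, -Complex.I; 0, 0, Complex.I, 0; 0, Complex.I, 0, 0; -Complex.I, 0, 0, 0],
    !![0, 0, 1, 0; 0, 0, 0, -1; -1, 0, 0, 0; 0, 1, 0, 0]]

/-- The free Dirac operator `-i ∑ₐ γ⁰ γᵃ ∂ₐ + m γ⁰` is, after the Fourier transform
`𝓕 f ξ = ∫ exp (-2π i x·ξ) f x dx`, multiplication by this Hermitian matrix: `-i ∂ₐ` becomes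
multiplication by the momentum component `pₐ = 2π ξₐ`. -/
def diracSymbol (m : ℝ) (ξ : Space) : Matrix (Fin 4) (Fin 4) ℂ :=
  (∑ a : Fin 3, ((2 * Real.pi * ξ a : ℝ) : ℂ) • (gamma0 * gamma a)) + (m : ℂ) • gamma0

/-- The spectral subspace of a Hermitian matrix for the set `B` of real numbers: the sum of the
eigenspaces for the eigenvalues in `B`. -/
def matrixSpectralSubspace (M : Matrix (Fin 4) (Fin 4) ℂ) (B : Set ℝ) : Submodule ℂ Spin :=
  ⨆ μ ∈ B, Module.End.eigenspace (Matrix.toEuclideanLin M) (μ : ℂ)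

/-- The spectral subspace of the Dirac operator for the set `B`: the functions whose Fourier
transform lies pointwise in the spectral subspace of the symbol. -/
def spectralSubspace (m : ℝ) (B : Set ℝ) : Submodule ℂ OneParticle where
  carrier := {f | ∀ᵐ ξ, (𝓕 f : OneParticle) ξ ∈ matrixSpectralSubspace (diracSymbol m ξ) B}
  zero_mem' := by
    have h : (𝓕 (0 : OneParticle) : OneParticle) = 0 :=
      map_zero (Lp.fourierTransformₗᵢ Space Spin)
    simp only [Set.mem_ofPred_eq, h]
    filter_upwards [Lp.coeFn_zero Spin 2 (volume : Measure Space)] with ξ hξ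
    rw [hξ]
    exact zero_mem _
  add_mem' := by
    intro f g hf hg
    have h : (𝓕 (f + g) : OneParticle) = 𝓕 f + 𝓕 g :=
      map_add (Lp.fourierTransformₗᵢ Space Spin) f g
    simp only [Set.mem_ofPred_eq, h] at hf hg ⊢
    filter_upwards [hf, hg, Lp.coeFn_add (𝓕 f : OneParticle) (𝓕 g)] with ξ h1 h2 h3
    rw [h3]
    exact add_mem h1 h2
  smul_mem' := by
    intro c f hf
    have h : (𝓕 (c • f) : OneParticle) = c • (𝓕 f : OneParticle) :=
      map_smul (Lp.fourierTransformₗᵢ Space Spin) c f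
    simp only [Set.mem_ofPred_eq, h] at hf ⊢
    filter_upwards [hf, Lp.coeFn_smul c (𝓕 f : OneParticle)] with ξ h1 h2
    rw [h2]
    exact Submodule.smul_mem _ c h1

theorem isClosed_spectralSubspace (m : ℝ) (B : Set ℝ) :
    IsClosed (spectralSubspace m B : Set OneParticle) := by
  refine IsSeqClosed.isClosed fun u f hu hf => ?_
  have h1 : Tendsto (fun n => (𝓕 (u n) : OneParticle)) atTop (𝓝 (𝓕 f : OneParticle)) :=
    ((Lp.fourierTransformₗᵢ Space Spin).continuous.tendsto f).comp hf
  obtain ⟨ns, -, h2⟩ := (tendstoInMeasure_of_tendsto_Lp h1).exists_seq_tendsto_ae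
  have h3 : ∀ᵐ ξ, ∀ n, (𝓕 (u n) : OneParticle) ξ ∈
      matrixSpectralSubspace (diracSymbol m ξ) B := ae_all_iff.mpr hu
  filter_upwards [h2, h3] with ξ h4 h5
  exact (Submodule.closed_of_finiteDimensional _).mem_of_tendsto h4
    (Eventually.of_forall fun n => h5 (ns n))

instance (m : ℝ) (B : Set ℝ) : CompleteSpace (spectralSubspace m B) :=
  (isClosed_spectralSubspace m B).completeSpace_coe

/-- The positive spectral subspace `h₊` of the Dirac operator. -/
abbrev hPlus (m : ℝ) : Submodule ℂ OneParticle := spectralSubspace m (Set.Ioi 0)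

/-- The negative spectral subspace `h₋` of the Dirac operator. -/
abbrev hMinus (m : ℝ) : Submodule ℂ OneParticle := spectralSubspace m (Set.Iio 0)

/-- The orthogonal projection `P₊` onto `h₊`. -/
def projPlus (m : ℝ) : OneParticle →L[ℂ] hPlus m := (hPlus m).orthogonalProjectionOnto

/-- The orthogonal projection `P₋` onto `h₋`. -/
def projMinus (m : ℝ) : OneParticle →L[ℂ] hMinus m := (hMinus m).orthogonalProjectionOnto

/-- Charge conjugation on spin space, `v ↦ i γ² v̄`. -/
def spinConj : Spin →SL[starRingEnd ℂ] Spin where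
  toFun v := WithLp.toLp 2 ((Complex.I • gamma 1).mulVec fun s => starRingEnd ℂ (v s))
  map_add' v w := by
    ext s
    simp [Matrix.mulVec, dotProduct, Finset.sum_add_distrib, mul_add]
  map_smul' c v := by
    ext s
    simp only [Matrix.mulVec, dotProduct, PiLp.smul_apply, smul_eq_mul, map_mul, Finset.mul_sum]
    exact Finset.sum_congr rfl fun t _ => by ring
  cont := by
    refine (PiLp.continuous_toLp 2 _).comp (continuous_pi fun s => ?_)
    simp only [Matrix.mulVec, dotProduct]
    refine continuous_finsetSum _ fun t _ => continuous_const.mul ?_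
    exact Complex.continuous_conj.comp (by fun_prop)

/-- The charge conjugation operator `C f = i γ² f̄` on the one-particle space. -/
def chargeConj : OneParticle →SL[starRingEnd ℂ] OneParticle :=
  ContinuousLinearMap.compLpL 2 volume spinConj

/-- The one-particle space `C h₋` of the antiparticles. -/
abbrev conjHMinus (m : ℝ) : Submodule ℂ OneParticle :=
  (hMinus m).map (chargeConj : OneParticle →ₛₗ[starRingEnd ℂ] OneParticle)

/-- The vector `C P₋ f`. -/
def conjProjMinus (m : ℝ) (f : OneParticle) : conjHMinus m :=
  ⟨chargeConj (projMinus m f), Submodule.mem_map_of_mem (projMinus m f).2⟩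

/-- The Hilbert space of the Dirac field, the Hilbert space tensor product of the fermionic Fock
spaces over `h₊` (particles) and over `C h₋` (antiparticles). -/
abbrev FockSpace (m : ℝ) : Type := Fermion.Fock₂ (hPlus m) (conjHMinus m)

/-- The vacuum vector `Ω`. -/
def vacuum (m : ℝ) : FockSpace m := Fermion.vacuum₂ (hPlus m) (conjHMinus m)

/-- The particle creation operator `b*(f)`. -/
def bStar (m : ℝ) (f : OneParticle) : FockSpace m →L[ℂ] FockSpace m :=
  Fermion.createFst (projPlus m f)

/-- The particle annihilation operator `b(f)`. -/
def b (m : ℝ) (f : OneParticle) : FockSpace m →L[ℂ] FockSpace m :=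
  Fermion.annihilateFst (projPlus m f)

/-- The antiparticle creation operator `c*(f)`. -/
def cStar (m : ℝ) (f : OneParticle) : FockSpace m →L[ℂ] FockSpace m :=
  Fermion.createSnd (conjProjMinus m f)

/-- The antiparticle annihilation operator `c(f)`. -/
def c (m : ℝ) (f : OneParticle) : FockSpace m →L[ℂ] FockSpace m :=
  Fermion.annihilateSnd (conjProjMinus m f)

/-- The field operator `Ψ(f) = b(f) + c*(f)`. -/
def field (m : ℝ) (f : OneParticle) : FockSpace m →L[ℂ] FockSpace m :=
  b m f + cStar m f

/-- The adjoint field operator `Ψ*(f) = b*(f) + c(f)`. -/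
def fieldStar (m : ℝ) (f : OneParticle) : FockSpace m →L[ℂ] FockSpace m :=
  bStar m f + c m f

/-- The vectors `Ψ*(g₁) ⋯ Ψ*(g_k) Ψ(h₁) ⋯ Ψ(h_l) Ω`, with `k, l ≥ 0`. -/
def polynomialVectors (m : ℝ) : Set (FockSpace m) :=
  {φ | ∃ g h : List OneParticle,
    φ = ((g.map (fieldStar m)).prod * (h.map (field m)).prod) (vacuum m)}

/-- The space `F` of polynomial states: the finite linear combinations of the polynomial
vectors. -/
def polynomialStates (m : ℝ) : Submodule ℂ (FockSpace m) :=
  Submodule.span ℂ (polynomialVectors m)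

/-- The normally ordered product
`:Ψ*(f) Ψ(f): = :(b*(f) + c(f)) (b(f) + c*(f)):`, in which the creation operator `c*(f)` is moved
to the left of `c(f)` with a minus sign. -/
def normalOrdered (m : ℝ) (f : OneParticle) : FockSpace m →L[ℂ] FockSpace m :=
  bStar m f * b m f + c m f * b m f + bStar m f * cStar m f - cStar m f * c m f

/-- The truncated charge operator, the sum of `:Ψ*(fⱼ) Ψ(fⱼ):` over the first `J` members of the
sequence `f`. -/
def truncatedCharge (m : ℝ) (f : ℕ → OneParticle) (J : ℕ) : FockSpace m →L[ℂ] FockSpace m :=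
  ∑ j ∈ Finset.range J, normalOrdered m (f j)

/-- The domain of the charge operator `∑ⱼ :Ψ*(fⱼ) Ψ(fⱼ):`: the vectors on which the series
converges. -/
def chargeDomain (m : ℝ) (f : ℕ → OneParticle) : Set (FockSpace m) :=
  {φ | ∃ χ, Tendsto (fun J => truncatedCharge m f J φ) atTop (𝓝 χ)}

/-- The subspace `L²(A, ℂ⁴)` of the functions in `L²(ℝ³, ℂ⁴)` that vanish outside `A`. -/
def L2On (A : Set Space) : Submodule ℂ OneParticle where
  carrier := {f | ∀ᵐ x, x ∉ A → f x = 0}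
  zero_mem' := by
    filter_upwards [Lp.coeFn_zero Spin 2 (volume : Measure Space)] with x hx _
    rw [hx]; rfl
  add_mem' := by
    intro f g hf hg
    filter_upwards [hf, hg, Lp.coeFn_add f g] with x h1 h2 h3 hx
    rw [h3, Pi.add_apply, h1 hx, h2 hx, add_zero]
  smul_mem' := by
    intro c f hf
    filter_upwards [hf, Lp.coeFn_smul c f] with x h1 h2 hx
    rw [h2, Pi.smul_apply, h1 hx, smul_zero]

/-- The cube `x + [-π, π]³`. -/
def cube (x : Space) : Set Space :=
  {y | ∀ i, y i - x i ∈ Set.Icc (-Real.pi) Real.pi}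

end DiracField

end

/-! The charge diverges because it creates too many pairs. The operators Ψ(f) and Ψ*(f) satisfy
canonical anticommutation relations (`isCAR_field`), and the normally ordered product is Ψ*(f)Ψ(f)
minus a constant (`normalOrdered_eq`). A polynomial state ψ involves only finitely many one-particle
vectors. If S is their span, then Ψ(e)ψ = 0 for e in h₊ orthogonal to S, and Ψ*(d)ψ = 0 for d in h₋
orthogonal to S.

For orthonormal families of such e and d, the vectors Ψ*(e)Ψ(d)ψ are orthogonal of norm ‖ψ‖. Their
inner product with Q^J ψ is ‖ψ‖² ∑_{j<J} ⟪e, f_j⟫⟪f_j, d⟫, which tends to ‖ψ‖² ⟪e, 1_A d⟫. By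
Bessel's inequality (`IsCAR.sum_norm_sq_le`) it suffices that the sums of |⟪e, 1_A d⟫|² are
unbounded, that is, that P₊ 1_A P₋ is not Hilbert-Schmidt. Restricting to vectors orthogonal to S
changes this operator only by finite rank (`exists_orthonormal_lt_sum`). The argument works for
every Hilbert basis of L²(A, ℂ⁴).

That P₊ 1_A P₋ is not Hilbert-Schmidt is shown with wave packets supported on small cubes of
momentum space (`exists_packets_lt_sum`). Spinors of positive energy at ξ and of negative energy at
η, with ξ - η fixed, have an overlap that decays only like the inverse of the energy. The cubes are
so small that the relative phase of two packets hardly varies over A, so the position integral does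
not cancel. The cubes form two sheets in the (ξ 1, ξ 2) directions, one for each sign of ξ 0. There
are k + 1 cubes at height k in the ξ 2 direction, each contributing at least a constant times 1/(k +
1)², and the harmonic series diverges. -/

noncomputable section

namespace Fermion

/-! ### Anticommutation relations on one Fock space -/

section OneSpecies

variable {E : Type*} [NormedAddCommGroup E] [InnerProductSpace ℂ E]

@[simp] theorem createL_apply (f : E) (u : Alg E) : createL f u = create f u := rfl

@[simp] theorem annihilateL_apply (f : E) (u : Alg E) : annihilateL f u = annihilate f u := rfl

@[simp] theorem parityL_apply (u : Alg E) : parityL u = parity u := rfl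

theorem createL_mul_createL (f g : E) : createL f * createL g = -(createL g * createL f) := by
  ext u
  exact create_create f g u

theorem annihilateL_mul_annihilateL (f g : E) :
    annihilateL f * annihilateL g = -(annihilateL g * annihilateL f) := by
  ext u
  exact CliffordAlgebra.contractLeft_comm (innerₛₗ ℂ f) (innerₛₗ ℂ g)
    (Q := (0 : QuadraticForm ℂ E)) u

theorem annihilateL_mul_createL (f g : E) :
    annihilateL f * createL g = ⟪f, g⟫_ℂ • 1 - createL g * annihilateL f := by
  ext u
  exact annihilate_create f g u

theorem parityL_mul_createL (f : E) :
    parityL * createL f = -(createL f * parityL) := by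
  ext u
  exact parity_create f u

theorem annihilateL_mul_parityL (f : E) :
    annihilateL f * parityL = -(parityL * annihilateL f) := by
  ext u
  exact annihilate_parity f u

theorem parityL_mul_parityL : (parityL * parityL : Alg E →L[ℂ] Alg E) = 1 := by
  ext u
  exact CliffordAlgebra.involute_involute u

theorem inner_createL_left (f : E) (u v : Alg E) :
    ⟪createL f u, v⟫_ℂ = ⟪u, annihilateL f v⟫_ℂ :=
  inner_create_left f u v

theorem inner_annihilateL_left (f : E) (u v : Alg E) :
    ⟪annihilateL f u, v⟫_ℂ = ⟪u, createL f v⟫_ℂ :=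
  fockInner_annihilate_left f u v

theorem inner_parityL_left (u v : Alg E) :
    ⟪parityL u, v⟫_ℂ = ⟪u, parityL v⟫_ℂ := by
  have h := inner_parity u (parity v)
  have h2 : parity (parity v) = v := congrArg (fun T : Alg E →L[ℂ] Alg E => T v) parityL_mul_parityL
  rw [h2] at h
  exact h

end OneSpecies

/-! ### Anticommutation relations for two species -/

section TwoSpecies

variable {E F : Type*} [NormedAddCommGroup E] [InnerProductSpace ℂ E]
  [NormedAddCommGroup F] [InnerProductSpace ℂ F]

theorem tensorOp_coe (S : Alg E →L[ℂ] Alg E) (T : Alg F →L[ℂ] Alg F) (u : Alg₂ E F) :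
    tensorOp S T (u : Fock₂ E F) = (TensorProduct.mapL S T u : Alg₂ E F) :=
  ContinuousLinearMap.completion_apply_coe _ _

/-- The algebraic tensor product is dense, so bounded operators are determined by their values on
it. -/
theorem fock₂_op_ext {S T : Fock₂ E F →L[ℂ] Fock₂ E F}
    (h : ∀ u : Alg₂ E F, S (u : Fock₂ E F) = T (u : Fock₂ E F)) : S = T := by
  ext φ
  induction φ using UniformSpace.Completion.induction_on with
  | hp => exact isClosed_eq S.continuous T.continuous
  | ih u => exact h u

theorem tensorOp_mul (S S' : Alg E →L[ℂ] Alg E) (T T' : Alg F →L[ℂ] Alg F) :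
    tensorOp S T * tensorOp S' T' = tensorOp (S * S') (T * T') := by
  refine fock₂_op_ext fun u => ?_
  rw [mul_apply_eq_comp, tensorOp_coe, tensorOp_coe, tensorOp_coe,
    TensorProduct.mapL_mul]
  rfl

theorem tensorOp_sub_left (S S' : Alg E →L[ℂ] Alg E) (T : Alg F →L[ℂ] Alg F) :
    tensorOp (S - S') T = tensorOp S T - tensorOp S' T := by
  refine fock₂_op_ext fun u => ?_
  have h : TensorProduct.mapL S T
      = TensorProduct.mapL (S - S') T + TensorProduct.mapL S' T := by
    rw [← TensorProduct.mapL_add_left, sub_add_cancel]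
  rw [sub_apply, tensorOp_coe, tensorOp_coe, tensorOp_coe, h,
    add_apply, UniformSpace.Completion.coe_add, add_sub_cancel_right]

theorem tensorOp_sub_right (S : Alg E →L[ℂ] Alg E) (T T' : Alg F →L[ℂ] Alg F) :
    tensorOp S (T - T') = tensorOp S T - tensorOp S T' := by
  refine fock₂_op_ext fun u => ?_
  have h : TensorProduct.mapL S T
      = TensorProduct.mapL S (T - T') + TensorProduct.mapL S T' := by
    rw [← TensorProduct.mapL_add_right, sub_add_cancel]
  rw [sub_apply, tensorOp_coe, tensorOp_coe, tensorOp_coe, h,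
    add_apply, UniformSpace.Completion.coe_add, add_sub_cancel_right]

theorem tensorOp_smul_left (c : ℂ) (S : Alg E →L[ℂ] Alg E) (T : Alg F →L[ℂ] Alg F) :
    tensorOp (c • S) T = c • tensorOp S T := by
  refine fock₂_op_ext fun u => ?_
  rw [smul_apply, tensorOp_coe, tensorOp_coe, TensorProduct.mapL_smul_left,
    smul_apply, UniformSpace.Completion.coe_smul]

theorem tensorOp_smul_right (c : ℂ) (S : Alg E →L[ℂ] Alg E) (T : Alg F →L[ℂ] Alg F) :
    tensorOp S (c • T) = c • tensorOp S T := by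
  refine fock₂_op_ext fun u => ?_
  rw [smul_apply, tensorOp_coe, tensorOp_coe, TensorProduct.mapL_smul_right,
    smul_apply, UniformSpace.Completion.coe_smul]

theorem tensorOp_neg_left (S : Alg E →L[ℂ] Alg E) (T : Alg F →L[ℂ] Alg F) :
    tensorOp (-S) T = -tensorOp S T := by
  rw [← neg_one_smul ℂ, tensorOp_smul_left, neg_one_smul]

theorem tensorOp_neg_right (S : Alg E →L[ℂ] Alg E) (T : Alg F →L[ℂ] Alg F) :
    tensorOp S (-T) = -tensorOp S T := by
  rw [← neg_one_smul ℂ, tensorOp_smul_right, neg_one_smul]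

theorem tensorOp_one : tensorOp (1 : Alg E →L[ℂ] Alg E) (1 : Alg F →L[ℂ] Alg F) = 1 := by
  refine fock₂_op_ext fun u => ?_
  rw [tensorOp_coe]
  exact congrArg (fun v : Alg₂ E F => (v : Fock₂ E F))
    (congrArg (fun T : Alg₂ E F →L[ℂ] Alg₂ E F => T u) TensorProduct.mapL_id_id)

theorem inner_tensorOp_left {S S' : Alg E →L[ℂ] Alg E} {T T' : Alg F →L[ℂ] Alg F}
    (hS : ∀ u v, ⟪S u, v⟫_ℂ = ⟪u, S' v⟫_ℂ) (hT : ∀ u v, ⟪T u, v⟫_ℂ = ⟪u, T' v⟫_ℂ)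
    (φ χ : Fock₂ E F) : ⟪tensorOp S T φ, χ⟫_ℂ = ⟪φ, tensorOp S' T' χ⟫_ℂ := by
  induction φ, χ using UniformSpace.Completion.induction_on₂ with
  | hp => exact isClosed_eq (by fun_prop) (by fun_prop)
  | ih u v =>
    rw [tensorOp_coe, tensorOp_coe, UniformSpace.Completion.inner_coe,
      UniformSpace.Completion.inner_coe]
    induction u using TensorProduct.induction_on with
    | zero => simp
    | add u u' hu hu' => rw [map_add, inner_add_left, inner_add_left, hu, hu']
    | tmul u₁ u₂ =>
      induction v using TensorProduct.induction_on with
      | zero => simp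
      | add v v' hv hv' => rw [map_add, inner_add_right, inner_add_right, hv, hv']
      | tmul v₁ v₂ =>
        rw [TensorProduct.mapL_tmul, TensorProduct.mapL_tmul, TensorProduct.inner_tmul,
          TensorProduct.inner_tmul, hS, hT]

theorem inner_createFst_left (e : E) (φ χ : Fock₂ E F) :
    ⟪createFst e φ, χ⟫_ℂ = ⟪φ, annihilateFst e χ⟫_ℂ :=
  inner_tensorOp_left (inner_createL_left e) (fun _ _ => rfl) φ χ

theorem inner_annihilateSnd_left (e : F) (φ χ : Fock₂ E F) :
    ⟪annihilateSnd e φ, χ⟫_ℂ = ⟪φ, createSnd e χ⟫_ℂ :=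
  inner_tensorOp_left inner_parityL_left (inner_annihilateL_left e) φ χ

theorem createFst_mul_createFst (e e' : E) :
    (createFst e * createFst e' : Fock₂ E F →L[ℂ] Fock₂ E F) = -(createFst e' * createFst e) := by
  simp only [createFst, tensorOp_mul]
  rw [createL_mul_createL, tensorOp_neg_left]

theorem annihilateFst_mul_annihilateFst (e e' : E) :
    (annihilateFst e * annihilateFst e' : Fock₂ E F →L[ℂ] Fock₂ E F)
      = -(annihilateFst e' * annihilateFst e) := by
  simp only [annihilateFst, tensorOp_mul]
  rw [annihilateL_mul_annihilateL, tensorOp_neg_left]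

theorem annihilateFst_mul_createFst (e e' : E) :
    (annihilateFst e * createFst e' : Fock₂ E F →L[ℂ] Fock₂ E F)
      = ⟪e, e'⟫_ℂ • 1 - createFst e' * annihilateFst e := by
  simp only [annihilateFst, createFst, tensorOp_mul]
  rw [annihilateL_mul_createL, tensorOp_sub_left, tensorOp_smul_left]
  congr 2
  exact tensorOp_one

theorem createSnd_mul_createSnd (d d' : F) :
    (createSnd d * createSnd d' : Fock₂ E F →L[ℂ] Fock₂ E F) = -(createSnd d' * createSnd d) := by
  simp only [createSnd, tensorOp_mul]
  rw [createL_mul_createL, tensorOp_neg_right]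

theorem annihilateSnd_mul_annihilateSnd (d d' : F) :
    (annihilateSnd d * annihilateSnd d' : Fock₂ E F →L[ℂ] Fock₂ E F)
      = -(annihilateSnd d' * annihilateSnd d) := by
  simp only [annihilateSnd, tensorOp_mul]
  rw [annihilateL_mul_annihilateL, tensorOp_neg_right]

theorem annihilateSnd_mul_createSnd (d d' : F) :
    (annihilateSnd d * createSnd d' : Fock₂ E F →L[ℂ] Fock₂ E F)
      = ⟪d, d'⟫_ℂ • 1 - createSnd d' * annihilateSnd d := by
  simp only [annihilateSnd, createSnd, tensorOp_mul]
  rw [annihilateL_mul_createL, tensorOp_sub_right, tensorOp_smul_right, parityL_mul_parityL,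
    tensorOp_one]

/-- Operators on different tensor factors would commute. The parity on the first factor of
`createSnd` supplies the sign, here and in the three mixed relations that follow. -/
theorem createFst_mul_createSnd (e : E) (d : F) :
    createFst e * createSnd d = -(createSnd d * createFst e) := by
  simp only [createFst, createSnd, tensorOp_mul]
  rw [parityL_mul_createL, tensorOp_neg_left, neg_neg]
  rfl

theorem createFst_mul_annihilateSnd (e : E) (d : F) :
    createFst e * annihilateSnd d = -(annihilateSnd d * createFst e) := by
  simp only [createFst, annihilateSnd, tensorOp_mul]
  rw [parityL_mul_createL, tensorOp_neg_left, neg_neg]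
  rfl

theorem annihilateFst_mul_createSnd (e : E) (d : F) :
    annihilateFst e * createSnd d = -(createSnd d * annihilateFst e) := by
  simp only [annihilateFst, createSnd, tensorOp_mul]
  rw [annihilateL_mul_parityL, tensorOp_neg_left]
  rfl

theorem annihilateFst_mul_annihilateSnd (e : E) (d : F) :
    annihilateFst e * annihilateSnd d = -(annihilateSnd d * annihilateFst e) := by
  simp only [annihilateFst, annihilateSnd, tensorOp_mul]
  rw [annihilateL_mul_parityL, tensorOp_neg_left]
  rfl

theorem annihilateFst_vacuum₂ (e : E) : annihilateFst e (vacuum₂ E F) = 0 := by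
  have h : annihilate e (1 : Alg E) = 0 := by
    simpa using annihilate_algebraMap e 1
  rw [annihilateFst, vacuum₂, tensorOp_coe, TensorProduct.mapL_tmul, annihilateL_apply, h,
    TensorProduct.zero_tmul, UniformSpace.Completion.coe_zero]

theorem annihilateSnd_vacuum₂ (d : F) : annihilateSnd d (vacuum₂ E F) = 0 := by
  have h : annihilate d (1 : Alg F) = 0 := by
    simpa using annihilate_algebraMap d 1
  rw [annihilateSnd, vacuum₂, tensorOp_coe, TensorProduct.mapL_tmul, annihilateL_apply, h,
    TensorProduct.tmul_zero, UniformSpace.Completion.coe_zero]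

@[simp] theorem createSnd_zero : (createSnd (0 : F) : Fock₂ E F →L[ℂ] Fock₂ E F) = 0 := by
  have h : createL (0 : F) = (0 : ℂ) • (0 : Alg F →L[ℂ] Alg F) := by
    ext u
    simp [create]
  rw [createSnd, h, tensorOp_smul_right, zero_smul]

@[simp] theorem createFst_zero : (createFst (0 : E) : Fock₂ E F →L[ℂ] Fock₂ E F) = 0 := by
  have h : createL (0 : E) = (0 : ℂ) • (0 : Alg E →L[ℂ] Alg E) := by
    ext u
    simp [create]
  rw [createFst, h, tensorOp_smul_left, zero_smul]

end TwoSpecies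

/-! ### Field operators of two species and normal ordering -/

section Ring

variable {R : Type*} [Ring R]

theorem add_mul_add_anticomm {a a' c c' : R} (h₁ : a * a' = -(a' * a)) (h₂ : c * c' = -(c' * c))
    (h₃ : a * c' = -(c' * a)) (h₄ : a' * c = -(c * a')) :
    (a + c) * (a' + c') = -((a' + c') * (a + c)) := by
  simp only [mul_add, add_mul]
  rw [h₁, h₂, h₃, h₄]
  abel

theorem add_mul_add_eq_sub {a a' c c' k l : R} (h₁ : a * a' = k - a' * a)
    (h₂ : c' * c = l - c * c') (h₃ : a * c' = -(c' * a)) (h₄ : a' * c = -(c * a')) :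
    (a + c) * (a' + c') = k + l - (a' + c') * (a + c) := by
  simp only [mul_add, add_mul]
  rw [h₁, h₂, h₃, h₄]
  abel

/-- Only the product `c * c'` is out of normal order, and reordering it costs the scalar `l`. -/
theorem normalOrder_eq {a a' c c' l : R} (h : c * c' = l - c' * c) :
    a' * a + c * a + a' * c' - c' * c = (a' + c) * (a + c') - l := by
  simp only [mul_add, add_mul]
  rw [h]
  abel

end Ring

section TwoSpecies

variable {E F : Type*} [NormedAddCommGroup E] [InnerProductSpace ℂ E]
  [NormedAddCommGroup F] [InnerProductSpace ℂ F]

/-- The operator `a(e) + c*(d)`. -/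
def lower (e : E) (d : F) : Fock₂ E F →L[ℂ] Fock₂ E F :=
  annihilateFst (F := F) e + createSnd (E := E) d

/-- The operator `a*(e) + c(d)`. -/
def raise (e : E) (d : F) : Fock₂ E F →L[ℂ] Fock₂ E F :=
  createFst (F := F) e + annihilateSnd (E := E) d

theorem inner_raise_left (e : E) (d : F) (φ χ : Fock₂ E F) :
    ⟪raise e d φ, χ⟫_ℂ = ⟪φ, lower e d χ⟫_ℂ := by
  rw [raise, lower, add_apply, add_apply, inner_add_left, inner_add_right, inner_createFst_left,
    inner_annihilateSnd_left]

theorem lower_mul_lower (e e' : E) (d d' : F) :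
    lower e d * lower e' d' = -(lower e' d' * lower e d) :=
  add_mul_add_anticomm (annihilateFst_mul_annihilateFst e e') (createSnd_mul_createSnd d d')
    (annihilateFst_mul_createSnd e d') (annihilateFst_mul_createSnd e' d)

theorem raise_mul_raise (e e' : E) (d d' : F) :
    raise e d * raise e' d' = -(raise e' d' * raise e d) :=
  add_mul_add_anticomm (createFst_mul_createFst e e') (annihilateSnd_mul_annihilateSnd d d')
    (createFst_mul_annihilateSnd e d') (createFst_mul_annihilateSnd e' d)

-- The second inner product has its arguments exchanged because `d` is created, not annihilated, by
-- `lower e d`. Since charge conjugation is antilinear, this exchange is undone for the Dirac field.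
set_option synthInstance.maxHeartbeats 200000 in
theorem lower_mul_raise (e e' : E) (d d' : F) {r : ℂ} (hr : ⟪e, e'⟫_ℂ + ⟪d', d⟫_ℂ = r) :
    lower e d * raise e' d' = r • 1 - raise e' d' * lower e d := by
  rw [← hr, add_smul]
  exact add_mul_add_eq_sub (annihilateFst_mul_createFst e e') (annihilateSnd_mul_createSnd d' d)
    (annihilateFst_mul_annihilateSnd e d') (createFst_mul_createSnd e' d)

theorem normalOrdered_eq_raise_mul_lower (e : E) (d : F) :
    createFst e * annihilateFst e + annihilateSnd d * annihilateFst e + createFst e * createSnd d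
      - createSnd d * annihilateSnd d = raise e d * lower e d - ⟪d, d⟫_ℂ • 1 :=
  normalOrder_eq (annihilateSnd_mul_createSnd d d)

theorem lower_vacuum₂ (e : E) {d : F} (hd : d = 0) : lower e d (vacuum₂ E F) = 0 := by
  rw [hd, lower, add_apply, annihilateFst_vacuum₂, createSnd_zero, zero_apply, add_zero]

theorem raise_vacuum₂ {e : E} (he : e = 0) (d : F) : raise e d (vacuum₂ E F) = 0 := by
  rw [he, raise, add_apply, annihilateSnd_vacuum₂, createFst_zero, zero_apply, zero_add]

end TwoSpecies

/-! ### Polynomial states and pair creation -/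

section CAR

variable {V H : Type*} [NormedAddCommGroup H] [InnerProductSpace ℂ H]

/-- A pair of families of mutually adjoint operators that satisfy the canonical anticommutation
relations for a form `s` on `V`. -/
structure IsCAR (A As : V → H →L[ℂ] H) (s : V → V → ℂ) : Prop where
  inner_left : ∀ f φ χ, ⟪As f φ, χ⟫_ℂ = ⟪φ, A f χ⟫_ℂ
  lower_lower : ∀ f g, A f * A g = -(A g * A f)
  raise_raise : ∀ f g, As f * As g = -(As g * As f)
  lower_raise : ∀ f g, A f * As g = s f g • 1 - As g * A f

namespace IsCAR

variable {A As : V → H →L[ℂ] H} {s : V → V → ℂ}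

theorem inner_right (h : IsCAR A As s) (f : V) (φ χ : H) :
    ⟪A f φ, χ⟫_ℂ = ⟪φ, As f χ⟫_ℂ := by
  rw [← inner_conj_symm, ← h.inner_left, inner_conj_symm]

theorem lower_lower_apply (h : IsCAR A As s) (f g : V) (φ : H) :
    A f (A g φ) = -(A g (A f φ)) :=
  congrArg (fun T : H →L[ℂ] H => T φ) (h.lower_lower f g)

theorem raise_raise_apply (h : IsCAR A As s) (f g : V) (φ : H) :
    As f (As g φ) = -(As g (As f φ)) :=
  congrArg (fun T : H →L[ℂ] H => T φ) (h.raise_raise f g)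

theorem lower_raise_apply (h : IsCAR A As s) (f g : V) (φ : H) :
    A f (As g φ) = s f g • φ - As g (A f φ) :=
  congrArg (fun T : H →L[ℂ] H => T φ) (h.lower_raise f g)

theorem raise_lower_apply (h : IsCAR A As s) (f g : V) (φ : H) :
    As g (A f φ) = s f g • φ - A f (As g φ) := by
  rw [h.lower_raise_apply, sub_sub_cancel]

/-- Moving `A e` to the right through the word yields scalars only at the raising factors, and these
scalars are zero; what remains acts on the vacuum. -/
theorem lower_word_eq_zero (h : IsCAR A As s) {Ω : H} {e : V} (he : A e Ω = 0) {g : List V}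
    (hg : ∀ v ∈ g, s e v = 0) (l : List V) :
    A e (((g.map As).prod * (l.map A).prod) Ω) = 0 := by
  induction g with
  | nil =>
    simp only [List.map_nil, List.prod_nil, one_mul]
    induction l with
    | nil => simpa using he
    | cons v l ih =>
      rw [List.map_cons, List.prod_cons, mul_apply_eq_comp, h.lower_lower_apply, ih, map_zero,
        neg_zero]
  | cons v g ih =>
    rw [List.map_cons, List.prod_cons, mul_assoc, mul_apply_eq_comp, h.lower_raise_apply,
      ih fun w hw => hg w (List.mem_cons_of_mem _ hw), hg v List.mem_cons_self, map_zero,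
      zero_smul, sub_zero]

theorem raise_word_eq_zero (h : IsCAR A As s) {Ω : H} {d : V} (hd : As d Ω = 0) (g : List V)
    {l : List V} (hl : ∀ v ∈ l, s v d = 0) :
    As d (((g.map As).prod * (l.map A).prod) Ω) = 0 := by
  induction g with
  | nil =>
    simp only [List.map_nil, List.prod_nil, one_mul]
    induction l with
    | nil => simpa using hd
    | cons v l ih =>
      rw [List.map_cons, List.prod_cons, mul_apply_eq_comp, h.raise_lower_apply,
        ih fun w hw => hl w (List.mem_cons_of_mem _ hw), hl v List.mem_cons_self, map_zero,
        zero_smul, sub_zero]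
  | cons v g ih =>
    rw [List.map_cons, List.prod_cons, mul_assoc, mul_apply_eq_comp, h.raise_raise_apply, ih,
      map_zero, neg_zero]

/-- A polynomial state is annihilated by the lowering operators and by the raising operators that
annihilate the vacuum and that belong to vectors orthogonal to a finite-dimensional space. -/
theorem exists_finiteDimensional [AddCommGroup V] [Module ℂ V] (h : IsCAR A As s) {Ω ψ : H}
    (hψ : ψ ∈ Submodule.span ℂ {φ | ∃ g l : List V,
      φ = ((g.map As).prod * (l.map A).prod) Ω}) :
    ∃ S : Submodule ℂ V, FiniteDimensional ℂ S ∧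
      (∀ e, A e Ω = 0 → (∀ v ∈ S, s e v = 0) → A e ψ = 0) ∧
      (∀ d, As d Ω = 0 → (∀ v ∈ S, s v d = 0) → As d ψ = 0) := by
  induction hψ using Submodule.span_induction with
  | mem φ hφ =>
    obtain ⟨g, l, rfl⟩ := hφ
    -- For a single word, the exceptional space is spanned by its letters.
    refine ⟨Submodule.span ℂ {v | v ∈ g ++ l}, FiniteDimensional.span_of_finite ℂ
      (List.finite_toSet _), fun e he hv => ?_, fun d hd hv => ?_⟩
    · exact h.lower_word_eq_zero he (fun v hvg =>
        hv v (Submodule.subset_span (List.mem_append_left _ hvg))) l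
    · exact h.raise_word_eq_zero hd g fun v hvl =>
        hv v (Submodule.subset_span (List.mem_append_right _ hvl))
  | zero => exact ⟨⊥, inferInstance, by simp, by simp⟩
  | add φ χ _ _ hφ hχ =>
    obtain ⟨S, hS, h1, h2⟩ := hφ
    obtain ⟨T, hT, h3, h4⟩ := hχ
    refine ⟨S ⊔ T, inferInstance, fun e he hv => ?_, fun d hd hv => ?_⟩
    · rw [map_add, h1 e he fun v hvS => hv v (Submodule.mem_sup_left hvS),
        h3 e he fun v hvT => hv v (Submodule.mem_sup_right hvT), add_zero]
    · rw [map_add, h2 d hd fun v hvS => hv v (Submodule.mem_sup_left hvS),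
        h4 d hd fun v hvT => hv v (Submodule.mem_sup_right hvT), add_zero]
  | smul c φ _ hφ =>
    obtain ⟨S, hS, h1, h2⟩ := hφ
    refine ⟨S, hS, fun e he hv => ?_, fun d hd hv => ?_⟩
    · rw [map_smul, h1 e he hv, smul_zero]
    · rw [map_smul, h2 d hd hv, smul_zero]

/-- Since `A e` and `As d` annihilate `ψ`, anticommuting them towards `ψ` leaves only one
contraction of each kind. -/
theorem inner_pair_pair (h : IsCAR A As s) {ψ : H} {e e' d d' : V} (he : A e ψ = 0)
    (hd : As d ψ = 0) :
    ⟪As e (A d ψ), As e' (A d' ψ)⟫_ℂ = s e e' * s d' d * ⟪ψ, ψ⟫_ℂ := by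
  rw [h.inner_left, h.lower_raise_apply, h.lower_lower_apply, he, map_zero, neg_zero, map_zero,
    sub_zero, h.inner_right, map_smul, h.raise_lower_apply, hd, map_zero, sub_zero,
    inner_smul_right, inner_smul_right]
  ring

/-- The constant of normal ordering drops out because `ψ` is orthogonal to the pair state, by `A e ψ
= 0`. Hence the bound below does not see the diverging sum of these constants. -/
theorem inner_pair_charge (h : IsCAR A As s) {ψ : H} {e d : V} (he : A e ψ = 0)
    (hd : As d ψ = 0) (f : V) (r : ℂ) :
    ⟪As e (A d ψ), (As f * A f - r • 1) ψ⟫_ℂ = s e f * s f d * ⟪ψ, ψ⟫_ℂ := by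
  rw [h.inner_left, sub_apply, map_sub, mul_apply_eq_comp, smul_apply, one_apply_eq_self, map_smul,
    he, smul_zero, sub_zero, h.lower_raise_apply, h.lower_lower_apply, he, map_zero, neg_zero,
    map_zero, sub_zero, h.inner_right, map_smul, h.raise_lower_apply, hd, map_zero, sub_zero,
    inner_smul_right, inner_smul_right]
  ring

/-- Pairs created from orthonormal modes that are absent from `ψ` bound the truncated charge from
below. -/
theorem sum_norm_sq_le (h : IsCAR A As s) {ψ : H} {ι κ : Type*} [Fintype ι] [Fintype κ]
    [DecidableEq ι] [DecidableEq κ] {e : ι → V} {d : κ → V} (he : ∀ i, A (e i) ψ = 0)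
    (hd : ∀ k, As (d k) ψ = 0) (hee : ∀ i j, s (e i) (e j) = if i = j then 1 else 0)
    (hdd : ∀ k l, s (d k) (d l) = if k = l then 1 else 0)
    (hψ : ψ ≠ 0) {σ : Type*} (J : Finset σ) (f : σ → V) (r : σ → ℂ)
    {T : σ → H →L[ℂ] H} (hT : ∀ j, T j = As (f j) * A (f j) - r j • 1) :
    (∑ i, ∑ k, ‖∑ j ∈ J, s (e i) (f j) * s (f j) (d k)‖ ^ 2) * ‖ψ‖ ^ 2
      ≤ ‖(∑ j ∈ J, T j) ψ‖ ^ 2 := by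
  rw [sum_apply]
  simp only [hT]
  have hψ' : (‖ψ‖ : ℂ) ≠ 0 := by simpa using hψ
  -- By `inner_pair_pair` all pair states have norm `‖ψ‖`; divided by it they are orthonormal, and
  -- Bessel's inequality applies.
  set w : ι × κ → H := fun p => ((‖ψ‖ : ℂ)⁻¹) • As (e p.1) (A (d p.2) ψ) with hw
  have ho : Orthonormal ℂ w := by
    rw [orthonormal_iff_ite]
    rintro ⟨i, k⟩ ⟨i', k'⟩
    rw [hw]
    simp only [inner_smul_left, inner_smul_right, h.inner_pair_pair (he i) (hd k), hee, hdd,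
      inner_self_eq_norm_sq_to_K, map_inv₀, Complex.conj_ofReal, Prod.mk.injEq]
    by_cases h1 : i = i' <;> by_cases h2 : k' = k
    · subst h1; subst h2; simp; field_simp
    · simp [h2, Ne.symm h2]
    · simp [h1]
    · simp [h1]
  have hb := ho.sum_inner_products_le (∑ j ∈ J, (As (f j) * A (f j) - r j • 1) ψ)
    (s := Finset.univ)
  refine le_trans (le_of_eq ?_) hb
  rw [← Finset.univ_product_univ, Finset.sum_product, Finset.sum_mul]
  refine Finset.sum_congr rfl fun i _ => ?_
  rw [Finset.sum_mul]
  refine Finset.sum_congr rfl fun k _ => ?_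
  rw [hw]
  simp only [inner_smul_left, inner_sum, h.inner_pair_charge (he i) (hd k), map_inv₀,
    Complex.conj_ofReal, inner_self_eq_norm_sq_to_K]
  rw [← Finset.mul_sum, ← Finset.sum_mul, norm_mul, norm_mul, norm_inv, norm_pow]
  have h3 : ‖(‖ψ‖ : ℂ)‖ = ‖ψ‖ := by simp
  have h4 : ‖ψ‖ ≠ 0 := by simpa using hψ
  simp only [Complex.coe_algebraMap, h3]
  field_simp

end IsCAR

end CAR

end Fermion

/-! ### The Dirac field as an instance of the relations -/

namespace DiracField

theorem inner_spinConj (v w : Spin) : ⟪spinConj v, spinConj w⟫_ℂ = ⟪w, v⟫_ℂ := by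
  simp only [spinConj, PiLp.inner_apply, Fin.sum_univ_four]
  simp [gamma, dotProduct, Fin.sum_univ_four]
  ring

theorem inner_chargeConj (f g : OneParticle) : ⟪chargeConj f, chargeConj g⟫_ℂ = ⟪g, f⟫_ℂ := by
  rw [L2.inner_def, L2.inner_def]
  refine integral_congr_ae ?_
  filter_upwards [ContinuousLinearMap.coeFn_compLp spinConj f,
    ContinuousLinearMap.coeFn_compLp spinConj g] with x hf hg
  have hf' : (chargeConj f) x = spinConj (f x) := hf
  have hg' : (chargeConj g) x = spinConj (g x) := hg
  rw [hf', hg', inner_spinConj]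

theorem isSymmetric_diracSymbol (m : ℝ) (ξ : Space) :
    (Matrix.toEuclideanLin (diracSymbol m ξ)).IsSymmetric := by
  rw [Matrix.isSymmetric_toEuclideanLin_iff]
  ext i j
  fin_cases i <;> fin_cases j <;>
    simp [diracSymbol, gamma, gamma0, Fin.sum_univ_three,
      Matrix.conjTranspose_apply]

theorem matrixSpectralSubspace_isOrtho {M : Matrix (Fin 4) (Fin 4) ℂ}
    (hM : (Matrix.toEuclideanLin M).IsSymmetric) {B B' : Set ℝ} (h : Disjoint B B') :
    matrixSpectralSubspace M B ⟂ matrixSpectralSubspace M B' := by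
  unfold matrixSpectralSubspace
  simp only [Submodule.isOrtho_iSup_left, Submodule.isOrtho_iSup_right]
  intro μ' hμ' μ hμ
  refine hM.orthogonalFamily_eigenspaces.isOrtho ?_
  rintro h'
  have : μ = μ' := by exact_mod_cast h'
  exact Set.disjoint_left.mp h (by assumption) (by subst this; assumption)

/-- By Plancherel it is enough to have orthogonality at each momentum, where it is that of
eigenspaces of a Hermitian matrix. -/
theorem inner_eq_zero_of_mem_spectralSubspace {m : ℝ} {B B' : Set ℝ} (h : Disjoint B B')
    {f g : OneParticle} (hf : f ∈ spectralSubspace m B) (hg : g ∈ spectralSubspace m B') :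
    ⟪f, g⟫_ℂ = 0 := by
  rw [← Lp.inner_fourier_eq, L2.inner_def]
  have hf' : ∀ᵐ ξ, (𝓕 f : OneParticle) ξ ∈ matrixSpectralSubspace (diracSymbol m ξ) B := hf
  have hg' : ∀ᵐ ξ, (𝓕 g : OneParticle) ξ ∈ matrixSpectralSubspace (diracSymbol m ξ) B' := hg
  rw [integral_eq_zero_of_ae]
  filter_upwards [hf', hg'] with ξ h1 h2
  exact (matrixSpectralSubspace_isOrtho (isSymmetric_diracSymbol m ξ) h).inner_eq h1 h2

theorem inner_hPlus_hMinus {m : ℝ} {f g : OneParticle} (hf : f ∈ hPlus m) (hg : g ∈ hMinus m) :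
    ⟪f, g⟫_ℂ = 0 :=
  inner_eq_zero_of_mem_spectralSubspace (Set.disjoint_left.mpr fun _ h h' => lt_asymm (Set.mem_Ioi.mp h) (Set.mem_Iio.mp h')) hf hg

theorem projPlus_of_mem {m : ℝ} {f : OneParticle} (hf : f ∈ hPlus m) :
    projPlus m f = ⟨f, hf⟩ :=
  Submodule.orthogonalProjectionOnto_mem_subspace_eq_self (⟨f, hf⟩ : hPlus m)

theorem projMinus_of_mem {m : ℝ} {f : OneParticle} (hf : f ∈ hMinus m) :
    projMinus m f = ⟨f, hf⟩ :=
  Submodule.orthogonalProjectionOnto_mem_subspace_eq_self (⟨f, hf⟩ : hMinus m)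

theorem projPlus_of_mem_hMinus {m : ℝ} {f : OneParticle} (hf : f ∈ hMinus m) :
    projPlus m f = 0 := by
  refine Submodule.orthogonalProjectionOnto_eq_zero_iff.mpr fun g hg => ?_
  exact inner_hPlus_hMinus hg hf

theorem projMinus_of_mem_hPlus {m : ℝ} {f : OneParticle} (hf : f ∈ hPlus m) :
    projMinus m f = 0 := by
  refine Submodule.orthogonalProjectionOnto_eq_zero_iff.mpr fun g hg => ?_
  rw [← inner_conj_symm, inner_hPlus_hMinus hf hg, map_zero]

/-- The inner product `⟪P₊ f, P₊ g⟫ + ⟪P₋ f, P₋ g⟫`. -/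
def splitInner (m : ℝ) (f g : OneParticle) : ℂ :=
  ⟪projPlus m f, projPlus m g⟫_ℂ + ⟪projMinus m f, projMinus m g⟫_ℂ

/-- The identity P₊ + P₋ = 1 is avoided: in every value of the form that matters, one argument lies
in `hPlus m` or in `hMinus m`, and then the form is the inner product. -/
theorem splitInner_of_mem_hPlus {m : ℝ} {f : OneParticle} (hf : f ∈ hPlus m) (g : OneParticle) :
    splitInner m f g = ⟪f, g⟫_ℂ := by
  rw [splitInner, projMinus_of_mem_hPlus hf, inner_zero_left, add_zero, projPlus_of_mem hf]
  exact Submodule.inner_orthogonalProjectionOnto_eq_of_mem_left (⟨f, hf⟩ : hPlus m) g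

theorem splitInner_of_mem_hMinus {m : ℝ} (f : OneParticle) {g : OneParticle} (hg : g ∈ hMinus m) :
    splitInner m f g = ⟪f, g⟫_ℂ := by
  rw [splitInner, projPlus_of_mem_hMinus hg, inner_zero_right, zero_add, projMinus_of_mem hg]
  exact Submodule.inner_orthogonalProjectionOnto_eq_of_mem_right (⟨g, hg⟩ : hMinus m) f

theorem inner_conjProjMinus (m : ℝ) (f g : OneParticle) :
    ⟪conjProjMinus m f, conjProjMinus m g⟫_ℂ = ⟪projMinus m g, projMinus m f⟫_ℂ :=
  inner_chargeConj _ _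

theorem conjProjMinus_of_mem_hPlus {m : ℝ} {f : OneParticle} (hf : f ∈ hPlus m) :
    conjProjMinus m f = 0 := by
  ext1
  simp [conjProjMinus, projMinus_of_mem_hPlus hf]

theorem isCAR_field (m : ℝ) : Fermion.IsCAR (field m) (fieldStar m) (splitInner m) where
  inner_left _ := Fermion.inner_raise_left _ _
  lower_lower _ _ := Fermion.lower_mul_lower _ _ _ _
  raise_raise _ _ := Fermion.raise_mul_raise _ _ _ _
  lower_raise f g := Fermion.lower_mul_raise (projPlus m f) (projPlus m g) (conjProjMinus m f)
    (conjProjMinus m g) (congrArg _ (inner_conjProjMinus m g f))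

theorem normalOrdered_eq (m : ℝ) (f : OneParticle) :
    normalOrdered m f = fieldStar m f * field m f
      - ⟪conjProjMinus m f, conjProjMinus m f⟫_ℂ • (1 : FockSpace m →L[ℂ] FockSpace m) :=
  Fermion.normalOrdered_eq_raise_mul_lower (projPlus m f) (conjProjMinus m f)

theorem field_vacuum {m : ℝ} {e : OneParticle} (he : e ∈ hPlus m) : field m e (vacuum m) = 0 :=
  Fermion.lower_vacuum₂ (projPlus m e) (conjProjMinus_of_mem_hPlus he)

theorem fieldStar_vacuum {m : ℝ} {d : OneParticle} (hd : d ∈ hMinus m) :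
    fieldStar m d (vacuum m) = 0 :=
  Fermion.raise_vacuum₂ (projPlus_of_mem_hMinus hd) (conjProjMinus m d)

/-- A polynomial state contains no particles and no antiparticles in the states orthogonal to a
finite-dimensional space, so that the pairs created in such states bound the truncated charge from
below. -/
theorem exists_sum_norm_sq_le_truncatedCharge {m : ℝ} {ψ : FockSpace m}
    (hψ : ψ ∈ polynomialStates m) (hψ0 : ψ ≠ 0) :
    ∃ S : Submodule ℂ OneParticle, FiniteDimensional ℂ S ∧
      ∀ {ι κ : Type} [Fintype ι] [Fintype κ] {e : ι → OneParticle} {d : κ → OneParticle},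
        Orthonormal ℂ e → Orthonormal ℂ d → (∀ i, e i ∈ hPlus m ⊓ Sᗮ) →
        (∀ k, d k ∈ hMinus m ⊓ Sᗮ) → ∀ (f : ℕ → OneParticle) (J : ℕ),
        (∑ i, ∑ k, ‖∑ j ∈ Finset.range J, ⟪e i, f j⟫_ℂ * ⟪f j, d k⟫_ℂ‖ ^ 2) * ‖ψ‖ ^ 2
          ≤ ‖truncatedCharge m f J ψ‖ ^ 2 := by
  classical
  obtain ⟨S, hS, h1, h2⟩ := (isCAR_field m).exists_finiteDimensional hψ
  refine ⟨S, hS, fun {ι κ} _ _ {e d} he hd heS hdS f J => ?_⟩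
  have heP i := (Submodule.mem_inf.mp (heS i)).1
  have hdP k := (Submodule.mem_inf.mp (hdS k)).1
  have hs i j : splitInner m (e i) (f j) = ⟪e i, f j⟫_ℂ := splitInner_of_mem_hPlus (heP i) _
  have hs' k j : splitInner m (f j) (d k) = ⟪f j, d k⟫_ℂ := splitInner_of_mem_hMinus _ (hdP k)
  simp only [← hs, ← hs']
  refine (isCAR_field m).sum_norm_sq_le (ψ := ψ) (e := e) (d := d)
    (fun i => h1 _ (field_vacuum (heP i)) fun v hv => ?_)
    (fun k => h2 _ (fieldStar_vacuum (hdP k)) fun v hv => ?_)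
    (fun i j => ?_) (fun k l => ?_) hψ0 (Finset.range J) f _ fun j => normalOrdered_eq m (f j)
  · rw [splitInner_of_mem_hPlus (heP i)]
    exact Submodule.inner_left_of_mem_orthogonal hv (Submodule.mem_inf.mp (heS i)).2
  · rw [splitInner_of_mem_hMinus _ (hdP k)]
    exact Submodule.inner_right_of_mem_orthogonal hv (Submodule.mem_inf.mp (hdS k)).2
  · rw [splitInner_of_mem_hPlus (heP i)]
    exact orthonormal_iff_ite.mp he i j
  · rw [splitInner_of_mem_hMinus _ (hdP l)]
    exact orthonormal_iff_ite.mp hd k l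

end DiracField

/-! ### Hilbert-Schmidt sums and finite-dimensional corrections -/

section HilbertSchmidt

variable {V : Type*} [NormedAddCommGroup V] [InnerProductSpace ℂ V] {ι : Type*} [Fintype ι]

theorem norm_sq_starProjection_eq_sum (E : Submodule ℂ V) [FiniteDimensional ℂ E] (z : V) :
    ‖E.starProjection z‖ ^ 2 = ∑ i, ‖⟪(stdOrthonormalBasis ℂ E i : V), z⟫_ℂ‖ ^ 2 := by
  have h := (stdOrthonormalBasis ℂ E).sum_sq_norm_inner_right (E.orthogonalProjectionOnto z)
  rw [Submodule.starProjection_apply, Submodule.norm_coe, ← h]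
  refine Finset.sum_congr rfl fun i _ => ?_
  rw [Submodule.inner_orthogonalProjectionOnto_eq_of_mem_left]

/-- The left side is part of the trace of the projection: expand in a basis of `E`, exchange the
sums, and apply Bessel's inequality to each basis vector. -/
theorem Orthonormal.sum_norm_sq_starProjection_le {e : ι → V} (he : Orthonormal ℂ e)
    (E : Submodule ℂ V) [FiniteDimensional ℂ E] :
    ∑ n, ‖E.starProjection (e n)‖ ^ 2 ≤ Module.finrank ℂ E := by
  simp only [norm_sq_starProjection_eq_sum]
  rw [Finset.sum_comm]
  have h : ∀ i, ∑ n, ‖⟪(stdOrthonormalBasis ℂ E i : V), e n⟫_ℂ‖ ^ 2 ≤ 1 := fun i => by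
    have hb := he.sum_inner_products_le (stdOrthonormalBasis ℂ E i : V) (s := Finset.univ)
    have h1 : ‖(stdOrthonormalBasis ℂ E i : V)‖ = 1 := (stdOrthonormalBasis ℂ E).orthonormal.1 i
    simp only [norm_inner_symm _ (e _)]
    simpa [h1] using hb
  refine (Finset.sum_le_sum fun i _ => h i).trans ?_
  simp

theorem Orthonormal.sum_norm_sq_inner_starProjection_le {e : ι → V} (he : Orthonormal ℂ e)
    (E : Submodule ℂ V) [FiniteDimensional ℂ E] (z : V) :
    ∑ n, ‖⟪E.starProjection (e n), z⟫_ℂ‖ ^ 2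
      ≤ ∑ i, ‖⟪(stdOrthonormalBasis ℂ E i : V), z⟫_ℂ‖ ^ 2 := by
  rw [← norm_sq_starProjection_eq_sum]
  simp only [Submodule.inner_starProjection_left_eq_right]
  exact he.sum_inner_products_le _

/-- The projected families are no longer orthonormal, but their diagonal sum is still at most the
squared Hilbert-Schmidt norm of the compression of `T`: enlarge it to the full matrix, then apply
Bessel's inequality in each argument in turn, passing to the adjoint in between. -/
theorem sum_norm_sq_inner_starProjection_le [CompleteSpace V] {e d : ι → V}
    (he : Orthonormal ℂ e) (hd : Orthonormal ℂ d) (E D : Submodule ℂ V) [FiniteDimensional ℂ E]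
    [FiniteDimensional ℂ D] (T : V →L[ℂ] V) :
    ∑ n, ‖⟪E.starProjection (e n), T (D.starProjection (d n))⟫_ℂ‖ ^ 2
      ≤ ∑ i, ∑ k, ‖⟪(stdOrthonormalBasis ℂ E i : V), T (stdOrthonormalBasis ℂ D k : V)⟫_ℂ‖ ^ 2 :=
  calc
    _ ≤ ∑ n, ∑ l, ‖⟪E.starProjection (e l), T (D.starProjection (d n))⟫_ℂ‖ ^ 2 :=
      Finset.sum_le_sum fun n _ => Finset.single_le_sum
        (f := fun l => ‖⟪E.starProjection (e l), T (D.starProjection (d n))⟫_ℂ‖ ^ 2)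
        (fun _ _ => by positivity) (Finset.mem_univ n)
    _ ≤ ∑ n, ∑ i, ‖⟪(stdOrthonormalBasis ℂ E i : V), T (D.starProjection (d n))⟫_ℂ‖ ^ 2 :=
      Finset.sum_le_sum fun n _ => he.sum_norm_sq_inner_starProjection_le E _
    _ = ∑ i, ∑ n, ‖⟪D.starProjection (d n),
        ContinuousLinearMap.adjoint T (stdOrthonormalBasis ℂ E i : V)⟫_ℂ‖ ^ 2 := by
      rw [Finset.sum_comm]
      refine Finset.sum_congr rfl fun i _ => Finset.sum_congr rfl fun n _ => ?_
      rw [ContinuousLinearMap.adjoint_inner_right, norm_inner_symm]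
    _ ≤ ∑ i, ∑ k, ‖⟪(stdOrthonormalBasis ℂ D k : V),
        ContinuousLinearMap.adjoint T (stdOrthonormalBasis ℂ E i : V)⟫_ℂ‖ ^ 2 :=
      Finset.sum_le_sum fun i _ => hd.sum_norm_sq_inner_starProjection_le D _
    _ = _ := by
      refine Finset.sum_congr rfl fun i _ => Finset.sum_congr rfl fun k _ => ?_
      rw [ContinuousLinearMap.adjoint_inner_right, norm_inner_symm]

/-- Removing from a vector of `X` its component in the projection of `S` onto `X` makes it
orthogonal to `S`. -/
theorem Submodule.sub_starProjection_map_mem (X S : Submodule ℂ V) [X.HasOrthogonalProjection]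
    [FiniteDimensional ℂ S] {v : V} (hv : v ∈ X) :
    v - (S.map (X.starProjection : V →ₗ[ℂ] V)).starProjection v ∈ X ⊓ Sᗮ := by
  set P := S.map (X.starProjection : V →ₗ[ℂ] V) with hP
  have hPX : P ≤ X := by
    rintro _ ⟨s, -, rfl⟩
    exact X.starProjection_apply_mem s
  have h1 : v - P.starProjection v ∈ X := X.sub_mem hv (hPX (P.starProjection_apply_mem v))
  refine ⟨h1, fun s hs => ?_⟩
  have h2 : ⟪X.starProjection s, v - P.starProjection v⟫_ℂ = 0 :=
    P.sub_starProjection_mem_orthogonal v _ ⟨s, hs, rfl⟩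
  rwa [Submodule.inner_starProjection_left_eq_right,
    Submodule.starProjection_eq_self_iff.mpr h1] at h2

/-- The removed component is the projection onto `X` of some `s` in `S`, and its inner product with
a vector of `E`, which lies in `X`, is that of `s` itself, hence zero. -/
theorem Submodule.starProjection_eq_sub_of_le (X S E : Submodule ℂ V) [X.HasOrthogonalProjection]
    [FiniteDimensional ℂ S] [E.HasOrthogonalProjection] (hE : E ≤ X ⊓ Sᗮ) {v : V}
    (hv : v - (S.map (X.starProjection : V →ₗ[ℂ] V)).starProjection v ∈ E) :
    E.starProjection v = v - (S.map (X.starProjection : V →ₗ[ℂ] V)).starProjection v := by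
  refine Submodule.eq_starProjection_of_mem_of_inner_eq_zero hv fun w hw => ?_
  rw [sub_sub_cancel]
  obtain ⟨s, hs, hs'⟩ := (S.map (X.starProjection : V →ₗ[ℂ] V)).starProjection_apply_mem v
  rw [← hs']
  have h : ⟪X.starProjection s, w⟫_ℂ = ⟪s, w⟫_ℂ := by
    rw [Submodule.inner_starProjection_left_eq_right,
      Submodule.starProjection_eq_self_iff.mpr (hE hw).1]
  exact h.trans ((hE hw).2 s hs)

theorem norm_add_add_sq_le (a b c : ℂ) :
    ‖a + b + c‖ ^ 2 ≤ 3 * (‖a‖ ^ 2 + ‖b‖ ^ 2 + ‖c‖ ^ 2) := by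
  have h := norm_add₃_le (a := a) (b := b) (c := c)
  have h0 := norm_nonneg (a + b + c)
  nlinarith [sq_nonneg (‖a‖ - ‖b‖), sq_nonneg (‖b‖ - ‖c‖), sq_nonneg (‖a‖ - ‖c‖)]

/-- If the compression of `T` from `Y` to `X` is not a Hilbert-Schmidt operator, then neither is
its compression between the subspaces orthogonal to a finite-dimensional space. -/
theorem exists_orthonormal_lt_sum [CompleteSpace V] (X Y S : Submodule ℂ V)
    [X.HasOrthogonalProjection] [Y.HasOrthogonalProjection] [FiniteDimensional ℂ S]
    (T : V →L[ℂ] V)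
    (h : ∀ R : ℝ, ∃ (ι : Type) (_ : Fintype ι) (e d : ι → V), Orthonormal ℂ e ∧ Orthonormal ℂ d ∧
      (∀ n, e n ∈ X) ∧ (∀ n, d n ∈ Y) ∧ R < ∑ n, ‖⟪e n, T (d n)⟫_ℂ‖ ^ 2) (R : ℝ) :
    ∃ (ι κ : Type) (_ : Fintype ι) (_ : Fintype κ) (e : ι → V) (d : κ → V), Orthonormal ℂ e ∧
      Orthonormal ℂ d ∧ (∀ i, e i ∈ X ⊓ Sᗮ) ∧ (∀ k, d k ∈ Y ⊓ Sᗮ) ∧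
      R < ∑ i, ∑ k, ‖⟪e i, T (d k)⟫_ℂ‖ ^ 2 := by
  set P := S.map (X.starProjection : V →ₗ[ℂ] V) with hP
  set Q := S.map (Y.starProjection : V →ₗ[ℂ] V) with hQ
  -- The factor 3 comes from `norm_add_add_sq_le`; the two dimensions bound the total error of the
  -- finite-rank corrections.
  obtain ⟨ι, _, e, d, he, hd, heX, hdY, hR⟩ :=
    h (3 * (R + ‖T‖ ^ 2 * Module.finrank ℂ P + ‖T‖ ^ 2 * Module.finrank ℂ Q))
  set E := Submodule.span ℂ (Set.range fun n => e n - P.starProjection (e n)) with hE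
  set D := Submodule.span ℂ (Set.range fun n => d n - Q.starProjection (d n)) with hD
  have : FiniteDimensional ℂ E := FiniteDimensional.span_of_finite ℂ (Set.finite_range _)
  have : FiniteDimensional ℂ D := FiniteDimensional.span_of_finite ℂ (Set.finite_range _)
  have hEX : E ≤ X ⊓ Sᗮ := by
    refine Submodule.span_le.mpr ?_
    rintro _ ⟨k, rfl⟩
    exact X.sub_starProjection_map_mem S (heX k)
  have hDY : D ≤ Y ⊓ Sᗮ := by
    refine Submodule.span_le.mpr ?_
    rintro _ ⟨k, rfl⟩
    exact Y.sub_starProjection_map_mem S (hdY k)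
  refine ⟨_, _, inferInstance, inferInstance, fun i => (stdOrthonormalBasis ℂ E i : V),
    fun k => (stdOrthonormalBasis ℂ D k : V),
    (stdOrthonormalBasis ℂ E).orthonormal.comp_linearIsometry E.subtypeₗᵢ,
    (stdOrthonormalBasis ℂ D).orthonormal.comp_linearIsometry D.subtypeₗᵢ,
    fun i => hEX (stdOrthonormalBasis ℂ E i).2, fun k => hDY (stdOrthonormalBasis ℂ D k).2, ?_⟩
  refine lt_of_lt_of_le ?_ (sum_norm_sq_inner_starProjection_le he hd E D T)
  have hterm (n : ι) : ‖⟪e n, T (d n)⟫_ℂ‖ ^ 2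
      ≤ 3 * (‖⟪E.starProjection (e n), T (D.starProjection (d n))⟫_ℂ‖ ^ 2
        + ‖T‖ ^ 2 * ‖P.starProjection (e n)‖ ^ 2 + ‖T‖ ^ 2 * ‖Q.starProjection (d n)‖ ^ 2) := by
    have h1 : E.starProjection (e n) = e n - P.starProjection (e n) :=
      X.starProjection_eq_sub_of_le S E hEX (Submodule.subset_span ⟨n, rfl⟩)
    have h2 : D.starProjection (d n) = d n - Q.starProjection (d n) :=
      Y.starProjection_eq_sub_of_le S D hDY (Submodule.subset_span ⟨n, rfl⟩)
    -- Each of the last two terms contains a projection of finite rank, so their squares have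
    -- bounded sums over `n`.
    have h3 : ⟪e n, T (d n)⟫_ℂ = ⟪E.starProjection (e n), T (D.starProjection (d n))⟫_ℂ
        + ⟪P.starProjection (e n), T (d n)⟫_ℂ
        + ⟪E.starProjection (e n), T (Q.starProjection (d n))⟫_ℂ := by
      rw [h1, h2, map_sub, inner_sub_right, inner_sub_left, inner_sub_left]
      ring
    have h4 : ‖⟪P.starProjection (e n), T (d n)⟫_ℂ‖ ≤ ‖T‖ * ‖P.starProjection (e n)‖ := by
      have := (norm_inner_le_norm (𝕜 := ℂ) (P.starProjection (e n)) (T (d n))).trans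
        (mul_le_mul_of_nonneg_left (T.le_opNorm (d n)) (norm_nonneg _))
      rw [hd.1 n] at this
      linarith
    have h5 : ‖⟪E.starProjection (e n), T (Q.starProjection (d n))⟫_ℂ‖
        ≤ ‖T‖ * ‖Q.starProjection (d n)‖ := by
      have h6 : ‖E.starProjection (e n)‖ ≤ 1 := by
        have := E.norm_starProjection_apply_le (e n)
        rwa [he.1 n] at this
      refine (norm_inner_le_norm (𝕜 := ℂ) _ _).trans ?_
      have h7 := T.le_opNorm (Q.starProjection (d n))
      have h8 := norm_nonneg (T (Q.starProjection (d n)))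
      nlinarith
    rw [h3]
    refine (norm_add_add_sq_le _ _ _).trans ?_
    rw [← mul_pow, ← mul_pow]
    gcongr
  have hsum := Finset.sum_le_sum fun n (_ : n ∈ Finset.univ) => hterm n
  rw [← Finset.mul_sum, Finset.sum_add_distrib, Finset.sum_add_distrib, ← Finset.mul_sum,
    ← Finset.mul_sum] at hsum
  have hp := mul_le_mul_of_nonneg_left (he.sum_norm_sq_starProjection_le P) (sq_nonneg ‖T‖)
  have hq := mul_le_mul_of_nonneg_left (hd.sum_norm_sq_starProjection_le Q) (sq_nonneg ‖T‖)
  linarith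

end HilbertSchmidt

/-! ### Hilbert bases indexed by the natural numbers -/

section HilbertBasis

variable {V : Type*} [NormedAddCommGroup V] [InnerProductSpace ℂ V]

theorem Orthonormal.norm_sub_sq_eq_two {ι : Type*} {v : ι → V} (hv : Orthonormal ℂ v) {i j : ι}
    (hij : i ≠ j) : ‖v i - v j‖ ^ 2 = 2 := by
  rw [_root_.norm_sub_sq (𝕜 := ℂ), hv.2 hij, hv.1, hv.1]
  norm_num

/-- Orthonormal vectors have distance √2, so the balls of radius 1/2 around them are disjoint open
sets. -/
theorem Orthonormal.countable_index [TopologicalSpace.SeparableSpace V] {ι : Type*} {v : ι → V}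
    (hv : Orthonormal ℂ v) : Countable ι := by
  rw [← Set.countable_univ_iff]
  refine Set.PairwiseDisjoint.countable_of_isOpen (s := fun i => Metric.ball (v i) (1 / 2))
    (fun i _ j _ hij => ?_) (fun _ _ => Metric.isOpen_ball)
    (fun i _ => ⟨v i, Metric.mem_ball_self (by norm_num)⟩)
  refine Set.disjoint_left.mpr fun z hz hz' => ?_
  have h1 := hv.norm_sub_sq_eq_two hij
  have h2 : dist (v i) (v j) < 1 := by
    have := dist_triangle_left (v i) (v j) z
    rw [Metric.mem_ball] at hz hz'
    linarith
  rw [dist_eq_norm] at h2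
  nlinarith [norm_nonneg (v i - v j)]

/-- An infinite-dimensional separable Hilbert space has a Hilbert basis indexed by `ℕ`. -/
theorem exists_hilbertBasis_nat [CompleteSpace V] [TopologicalSpace.SeparableSpace V]
    (h : ¬ FiniteDimensional ℂ V) : Nonempty (HilbertBasis ℕ ℂ V) := by
  obtain ⟨w, b, -⟩ := exists_hilbertBasis ℂ V
  have : Countable w := b.orthonormal.countable_index
  have : Infinite w := by
    by_contra hw
    have : Finite w := not_infinite_iff_finite.mp hw
    have : Fintype w := Fintype.ofFinite w
    exact h b.toOrthonormalBasis.toBasis.finiteDimensional_of_finite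
  obtain ⟨e⟩ := nonempty_equiv_of_countable (α := ℕ) (β := w)
  refine ⟨HilbertBasis.mk (b.orthonormal.comp e e.injective) ?_⟩
  rw [e.surjective.range_comp]
  exact b.dense_span.ge

/-- This is Parseval's identity in `K` for the projections of `e` and `d`. -/
theorem HilbertBasis.tendsto_sum_inner_mul_inner (K : Submodule ℂ V) [K.HasOrthogonalProjection]
    (f : HilbertBasis ℕ ℂ K) (e d : V) :
    Tendsto (fun J => ∑ j ∈ Finset.range J, ⟪e, (f j : V)⟫_ℂ * ⟪(f j : V), d⟫_ℂ) atTop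
      (𝓝 ⟪e, K.starProjection d⟫_ℂ) := by
  have h := (f.hasSum_inner_mul_inner (K.orthogonalProjectionOnto e)
    (K.orthogonalProjectionOnto d)).tendsto_sum_nat
  have h1 : ⟪e, K.starProjection d⟫_ℂ
      = ⟪K.orthogonalProjectionOnto e, K.orthogonalProjectionOnto d⟫_ℂ := by
    rw [Submodule.starProjection_apply,
      ← Submodule.inner_orthogonalProjectionOnto_eq_of_mem_right]
  rw [h1]
  refine h.congr fun J => Finset.sum_congr rfl fun j _ => ?_
  rw [Submodule.inner_orthogonalProjectionOnto_eq_of_mem_right,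
    Submodule.inner_orthogonalProjectionOnto_eq_of_mem_left]

end HilbertBasis

/-! ### From a non-Hilbert-Schmidt compression to a divergent charge -/

namespace DiracField

theorem isClosed_L2On (A : Set Space) : IsClosed (L2On A : Set OneParticle) := by
  refine IsSeqClosed.isClosed fun u f hu hf => ?_
  obtain ⟨ns, -, h2⟩ := (tendstoInMeasure_of_tendsto_Lp hf).exists_seq_tendsto_ae
  have h3 : ∀ᵐ x, ∀ n, x ∉ A → u n x = 0 := ae_all_iff.mpr hu
  filter_upwards [h2, h3] with x h4 h5 hx
  refine tendsto_nhds_unique h4 ?_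
  simp only [h5 _ hx]
  exact tendsto_const_nhds

instance (A : Set Space) : CompleteSpace (L2On A) := (isClosed_L2On A).completeSpace_coe

theorem starProjection_L2On {A : Set Space} (hA : MeasurableSet A) (f : OneParticle) :
    (L2On A).starProjection f = ((Lp.memLp f).indicator hA).toLp _ := by
  refine Submodule.eq_starProjection_of_mem_of_inner_eq_zero ?_ fun g hg => ?_
  · filter_upwards [((Lp.memLp f).indicator hA).coeFn_toLp] with x hx hxA
    rw [hx, Set.indicator_of_notMem hxA]
  · have hg' : ∀ᵐ x, x ∉ A → g x = 0 := hg
    rw [L2.inner_def, integral_eq_zero_of_ae]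
    filter_upwards [hg', ((Lp.memLp f).indicator hA).coeFn_toLp,
      Lp.coeFn_sub f (((Lp.memLp f).indicator hA).toLp _)] with x h1 h2 h3
    rw [h3, Pi.sub_apply, h2]
    by_cases hx : x ∈ A
    · simp [hx]
    · simp [h1 hx]

theorem inner_starProjection_L2On {A : Set Space} (hA : MeasurableSet A) (f g : OneParticle) :
    ⟪f, (L2On A).starProjection g⟫_ℂ = ∫ x in A, ⟪f x, g x⟫_ℂ := by
  rw [starProjection_L2On hA, L2.inner_def, ← integral_indicator hA]
  refine integral_congr_ae ?_
  filter_upwards [((Lp.memLp g).indicator hA).coeFn_toLp] with x h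
  rw [h]
  by_cases hx : x ∈ A <;> simp [hx]

theorem measurableSet_cube (x : Space) : MeasurableSet (cube x) := by
  have : cube x = ⋂ i, {y : Space | y i - x i ∈ Set.Icc (-Real.pi) Real.pi} := by
    ext y
    simp [cube]
  rw [this]
  exact MeasurableSet.iInter fun i => measurableSet_Icc.preimage (by fun_prop)

/-- If the compression to `h₊` and `h₋` of the projection onto `K` is not a Hilbert-Schmidt
operator, then the charge operator of any Hilbert basis of `K` diverges on the polynomial
states. -/
theorem tendsto_norm_truncatedCharge {m : ℝ} {ψ : FockSpace m} (hψ : ψ ∈ polynomialStates m)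
    (hψ0 : ψ ≠ 0) (K : Submodule ℂ OneParticle) [K.HasOrthogonalProjection]
    (f : HilbertBasis ℕ ℂ K)
    (h : ∀ R : ℝ, ∃ (ι : Type) (_ : Fintype ι) (e d : ι → OneParticle), Orthonormal ℂ e ∧
      Orthonormal ℂ d ∧ (∀ n, e n ∈ hPlus m) ∧ (∀ n, d n ∈ hMinus m) ∧
      R < ∑ n, ‖⟪e n, K.starProjection (d n)⟫_ℂ‖ ^ 2) :
    Tendsto (fun J : ℕ => ‖truncatedCharge m (fun j => (f j : OneParticle)) J ψ‖ ^ 2)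
      atTop atTop := by
  obtain ⟨S, hS, hbound⟩ := exists_sum_norm_sq_le_truncatedCharge hψ hψ0
  have hpos : 0 < ‖ψ‖ ^ 2 := by positivity
  refine tendsto_atTop.mpr fun R => ?_
  -- The finite families are fixed before `J`, so the limit in `J` passes through the finite double
  -- sum.
  obtain ⟨ι, κ, _, _, e, d, he, hd, heS, hdS, hR⟩ :=
    exists_orthonormal_lt_sum (hPlus m) (hMinus m) S K.starProjection h (R / ‖ψ‖ ^ 2)
  have hlim : Tendsto (fun J => ∑ i, ∑ k,
      ‖∑ j ∈ Finset.range J, ⟪e i, (f j : OneParticle)⟫_ℂ * ⟪(f j : OneParticle), d k⟫_ℂ‖ ^ 2)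
      atTop (𝓝 (∑ i, ∑ k, ‖⟪e i, K.starProjection (d k)⟫_ℂ‖ ^ 2)) :=
    tendsto_finsetSum _ fun i _ => tendsto_finsetSum _ fun k _ =>
      ((f.tendsto_sum_inner_mul_inner K (e i) (d k)).norm).pow 2
  filter_upwards [hlim.eventually_const_lt hR] with J hJ
  refine le_trans ?_ (hbound he hd heS hdS (fun j => (f j : OneParticle)) J)
  exact ((div_lt_iff₀ hpos).mp hJ).le

/-- In finite dimension the sums would be bounded by the dimension of `K`. This provides the
infinite dimension that a basis indexed by `ℕ` requires. -/
theorem not_finiteDimensional_of_lt_sum {m : ℝ} {K : Submodule ℂ OneParticle}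
    [K.HasOrthogonalProjection]
    (h : ∀ R : ℝ, ∃ (ι : Type) (_ : Fintype ι) (e d : ι → OneParticle), Orthonormal ℂ e ∧
      Orthonormal ℂ d ∧ (∀ n, e n ∈ hPlus m) ∧ (∀ n, d n ∈ hMinus m) ∧
      R < ∑ n, ‖⟪e n, K.starProjection (d n)⟫_ℂ‖ ^ 2) : ¬ FiniteDimensional ℂ K := by
  intro hK
  obtain ⟨ι, _, e, d, he, hd, -, -, hR⟩ := h (Module.finrank ℂ K)
  refine absurd (hd.sum_norm_sq_starProjection_le K) (not_le.mpr (hR.trans_le ?_))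
  refine Finset.sum_le_sum fun n _ => ?_
  have := norm_inner_le_norm (𝕜 := ℂ) (e n) (K.starProjection (d n))
  rw [he.1 n, one_mul] at this
  gcongr

theorem notMem_chargeDomain {m : ℝ} {ψ : FockSpace m} {f : ℕ → OneParticle}
    (h : Tendsto (fun J : ℕ => ‖truncatedCharge m f J ψ‖ ^ 2) atTop atTop) :
    ψ ∉ chargeDomain m f := by
  rintro ⟨χ, hχ⟩
  exact not_tendsto_nhds_of_tendsto_atTop h _ (hχ.norm.pow 2)

theorem exists_hilbertBasis_tendsto {m : ℝ} {ψ : FockSpace m} (hψ : ψ ∈ polynomialStates m)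
    (hψ0 : ψ ≠ 0) (A : Set Space)
    (h : ∀ R : ℝ, ∃ (ι : Type) (_ : Fintype ι) (e d : ι → OneParticle), Orthonormal ℂ e ∧
      Orthonormal ℂ d ∧ (∀ n, e n ∈ hPlus m) ∧ (∀ n, d n ∈ hMinus m) ∧
      R < ∑ n, ‖⟪e n, (L2On A).starProjection (d n)⟫_ℂ‖ ^ 2) :
    ∃ f : HilbertBasis ℕ ℂ (L2On A),
      Tendsto (fun J : ℕ => ‖truncatedCharge m (fun j => (f j : OneParticle)) J ψ‖ ^ 2)
        atTop atTop ∧ ψ ∉ chargeDomain m (fun j => (f j : OneParticle)) := by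
  -- Needed for the separability of L².
  have : Fact ((2 : ENNReal) ≠ ⊤) := ⟨by norm_num⟩
  obtain ⟨f⟩ := exists_hilbertBasis_nat (not_finiteDimensional_of_lt_sum h)
  have hf := tendsto_norm_truncatedCharge hψ hψ0 (L2On A) f h
  exact ⟨f, hf, notMem_chargeDomain hf⟩

end DiracField

/-! ### The inverse Fourier transform as an integral -/

section FourierIntegral

open scoped SchwartzMap

variable {E F : Type*} [NormedAddCommGroup E] [InnerProductSpace ℝ E] [FiniteDimensional ℝ E]
  [MeasurableSpace E] [BorelSpace E] [NormedAddCommGroup F] [InnerProductSpace ℂ F]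

theorem Real.continuous_fourierInv {g : E → F} (hg : Integrable g) : Continuous (𝓕⁻ g) :=
  VectorFourier.fourierIntegral_continuous (L := -innerₗ E) Real.continuous_fourierChar
    (continuous_inner.neg) hg

theorem Real.integral_fourierInv_smul_eq [CompleteSpace F] {f : E → ℂ} {g : E → F} (hf : Integrable f)
    (hg : Integrable g) : ∫ x, 𝓕⁻ f x • g x = ∫ x, f x • 𝓕⁻ g x := by
  have h := VectorFourier.integral_fourierIntegral_smul_eq_flip (L := -innerₗ E)
    (μ := volume) (ν := volume) Real.continuous_fourierChar (continuous_inner.neg)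
    hf hg
  have hL : (-innerₗ E).flip = -innerₗ E := by
    ext x y
    simp [real_inner_comm]
  rw [hL] at h
  exact h

/-- On an integrable function of `L²`, the inverse Fourier transform of `L²` is given by the
Fourier integral. -/
theorem MeasureTheory.Lp.coeFn_fourierInv [CompleteSpace F] (g : Lp (α := E) F 2) (hg : Integrable g) :
    (𝓕⁻ g : Lp (α := E) F 2) =ᵐ[volume] 𝓕⁻ (g : E → F) := by
  -- Both sides are tested against smooth functions of compact support. Moving the transform to the
  -- test function gives the same value, by distributional duality on one side and by Fubini on the
  -- other.
  refine ae_eq_of_integral_contDiff_smul_eq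
    (MemLp.locallyIntegrable (Lp.memLp (𝓕⁻ g : Lp F 2 (volume : Measure E))) one_le_two)
    (Real.continuous_fourierInv hg).locallyIntegrable fun φ hφ hφc => ?_
  let φ' : 𝓢(E, ℂ) := (hφc.comp_left (g := Complex.ofReal) Complex.ofReal_zero).toSchwartzMap
    (Complex.ofRealCLM.contDiff.comp hφ)
  have hφ' (x : E) : φ' x = (φ x : ℂ) := rfl
  have h1 := congrArg (fun T : 𝓢'(E, F) => T φ') (Lp.fourierInv_toTemperedDistribution_eq g)
  simp only [TemperedDistribution.fourierInv_apply, Lp.toTemperedDistribution_apply] at h1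
  have h2 := Real.integral_fourierInv_smul_eq (φ'.integrable (μ := volume)) hg
  rw [← SchwartzMap.fourierInv_coe, h1] at h2
  simpa only [hφ', Complex.coe_smul] using h2

end FourierIntegral

/-! ### Wave packets and their overlap on a cube -/

namespace DiracField

/-- The function on momentum space that is `w` on `Q`, with the phase that translates by `x` in
position space, and vanishes outside `Q`. -/
def packetSymbol (w : Space → Spin) (x : Space) (Q : Set Space) : Space → Spin :=
  Q.indicator fun ξ => (𝐞 (-⟪ξ, x⟫_ℝ) : Circle) • w ξ

theorem norm_circle_smul (a : Circle) (v : Spin) : ‖a • v‖ = ‖v‖ := by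
  rw [Circle.smul_def, norm_smul, Circle.norm_coe, one_mul]

theorem measurable_fourierChar_smul {w : Space → Spin} (hw : Measurable w) {φ : Space → ℝ}
    (hφ : Continuous φ) : Measurable fun ξ => (𝐞 (φ ξ) : Circle) • w ξ := by
  simp only [Circle.smul_def]
  exact (Continuous.subtype_val (Real.continuous_fourierChar.comp hφ)).measurable.smul hw

section Packet

variable {w : Space → Spin} {C : ℝ} {Q : Set Space}

theorem norm_packetSymbol_le (hC : ∀ ξ, ‖w ξ‖ ≤ C) (x : Space) (Q : Set Space) (ξ : Space) :
    ‖packetSymbol w x Q ξ‖ ≤ Q.indicator (fun _ => C) ξ := by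
  by_cases h : ξ ∈ Q
  · simpa [packetSymbol, h, norm_circle_smul] using hC ξ
  · simp [packetSymbol, h]

theorem measurable_packetSymbol (hw : Measurable w) (x : Space) (hQ : MeasurableSet Q) :
    Measurable (packetSymbol w x Q) := by
  exact (measurable_fourierChar_smul hw (by fun_prop)).indicator hQ

theorem memLp_packetSymbol (hw : Measurable w) (hC : ∀ ξ, ‖w ξ‖ ≤ C) (x : Space)
    (hQ : MeasurableSet Q) (hQ' : volume Q ≠ ⊤) (p : ENNReal) :
    MemLp (packetSymbol w x Q) p := by
  refine MemLp.mono (memLp_indicator_const p hQ C (Or.inr hQ'))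
    (measurable_packetSymbol hw x hQ).aestronglyMeasurable (ae_of_all _ fun ξ => ?_)
  exact (norm_packetSymbol_le hC x Q ξ).trans (le_abs_self _)

/-- The wave packet whose Fourier transform is `packetSymbol w x Q`. -/
def packet (hw : Measurable w) (hC : ∀ ξ, ‖w ξ‖ ≤ C) (x : Space)
    (hQ : MeasurableSet Q) (hQ' : volume Q ≠ ⊤) : OneParticle :=
  𝓕⁻ ((memLp_packetSymbol hw hC x hQ hQ' 2).toLp _ : OneParticle)

theorem fourier_packet (hw : Measurable w) (hC : ∀ ξ, ‖w ξ‖ ≤ C) (x : Space)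
    (hQ : MeasurableSet Q) (hQ' : volume Q ≠ ⊤) :
    (𝓕 (packet hw hC x hQ hQ') : OneParticle) =ᵐ[volume] packetSymbol w x Q := by
  rw [packet, FourierTransform.fourier_fourierInv_eq]
  exact MemLp.coeFn_toLp _

theorem packet_mem_spectralSubspace (hw : Measurable w) (hC : ∀ ξ, ‖w ξ‖ ≤ C) (x : Space)
    (hQ : MeasurableSet Q) (hQ' : volume Q ≠ ⊤) {m : ℝ} {B : Set ℝ}
    (h : ∀ ξ ∈ Q, w ξ ∈ matrixSpectralSubspace (diracSymbol m ξ) B) :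
    packet hw hC x hQ hQ' ∈ spectralSubspace m B := by
  filter_upwards [fourier_packet hw hC x hQ hQ'] with ξ hξ
  rw [hξ]
  by_cases hξQ : ξ ∈ Q
  · rw [packetSymbol, Set.indicator_of_mem hξQ]
    exact Submodule.smul_mem _ _ (h ξ hξQ)
  · rw [packetSymbol, Set.indicator_of_notMem hξQ]
    exact zero_mem _

theorem inner_packet_eq_zero (hw : Measurable w) (hC : ∀ ξ, ‖w ξ‖ ≤ C) (x : Space)
    (hQ : MeasurableSet Q) (hQ' : volume Q ≠ ⊤) {R : Set Space} (hR : MeasurableSet R)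
    (hR' : volume R ≠ ⊤) (h : Disjoint Q R) :
    ⟪packet hw hC x hQ hQ', packet hw hC x hR hR'⟫_ℂ = 0 := by
  rw [← Lp.inner_fourier_eq, L2.inner_def, integral_eq_zero_of_ae]
  filter_upwards [fourier_packet hw hC x hQ hQ', fourier_packet hw hC x hR hR'] with ξ h1 h2
  rw [h1, h2]
  by_cases hξ : ξ ∈ Q
  · simp [packetSymbol, Set.disjoint_left.mp h hξ]
  · simp [packetSymbol, hξ]

theorem norm_packet_sq_le (hw : Measurable w) (hC : ∀ ξ, ‖w ξ‖ ≤ C) (x : Space)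
    (hQ : MeasurableSet Q) (hQ' : volume Q ≠ ⊤) :
    ‖packet hw hC x hQ hQ'‖ ^ 2 ≤ C ^ 2 * volume.real Q := by
  have hC0 : 0 ≤ C := (norm_nonneg _).trans (hC 0)
  have h := L2.inner_def (𝕜 := ℂ) (𝓕 (packet hw hC x hQ hQ') : OneParticle)
    (𝓕 (packet hw hC x hQ hQ') : OneParticle)
  rw [Lp.inner_fourier_eq, inner_self_eq_norm_sq_to_K] at h
  have h1 : ‖packet hw hC x hQ hQ'‖ ^ 2
      = ‖∫ ξ, ⟪(𝓕 (packet hw hC x hQ hQ') : OneParticle) ξ,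
        (𝓕 (packet hw hC x hQ hQ') : OneParticle) ξ⟫_ℂ‖ := by
    rw [← h]
    simp
  have h2 : ∫ ξ, Q.indicator (fun _ => C ^ 2) ξ = C ^ 2 * volume.real Q := by
    rw [integral_indicator hQ, setIntegral_const, smul_eq_mul, mul_comm]
  rw [h1, ← h2]
  refine norm_integral_le_of_norm_le
    ((integrable_indicator_iff hQ).mpr (integrableOn_const hQ')) ?_
  filter_upwards [fourier_packet hw hC x hQ hQ'] with ξ h3
  rw [h3]
  refine (norm_inner_le_norm _ _).trans ?_
  have h4 := norm_packetSymbol_le hC x Q ξ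
  by_cases hξ : ξ ∈ Q
  · rw [Set.indicator_of_mem hξ] at h4 ⊢
    nlinarith [norm_nonneg (packetSymbol w x Q ξ)]
  · simp [packetSymbol, hξ]

/-- The superposition over `Q` of plane waves with amplitude `w`. -/
def planeWaves (w : Space → Spin) (Q : Set Space) (z : Space) : Spin :=
  ∫ ξ in Q, (𝐞 ⟪ξ, z⟫_ℝ : Circle) • w ξ

theorem coeFn_packet (hw : Measurable w) (hC : ∀ ξ, ‖w ξ‖ ≤ C) (x : Space)
    (hQ : MeasurableSet Q) (hQ' : volume Q ≠ ⊤) :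
    packet hw hC x hQ hQ' =ᵐ[volume] fun y => planeWaves w Q (y - x) := by
  have h0 := (memLp_packetSymbol hw hC x hQ hQ' 2).coeFn_toLp
  have hi : Integrable ((memLp_packetSymbol hw hC x hQ hQ' 2).toLp _ : OneParticle) :=
    (memLp_one_iff_integrable.mp (memLp_packetSymbol hw hC x hQ hQ' 1)).congr h0.symm
  refine (Lp.coeFn_fourierInv _ hi).trans (ae_of_all _ fun y => ?_)
  simp only [planeWaves]
  rw [Real.fourierInv_congr_ae h0, Real.fourierInv_eq, ← integral_indicator hQ]
  refine integral_congr_ae (ae_of_all _ fun ξ => ?_)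
  by_cases hξ : ξ ∈ Q
  · simp only [packetSymbol, Set.indicator_of_mem hξ, inner_sub_right, smul_smul]
    rw [← AddChar.map_add_eq_mul, sub_eq_add_neg]
  · simp [packetSymbol, hξ]

theorem integrableOn_planeWave (hw : Measurable w) (hC : ∀ ξ, ‖w ξ‖ ≤ C)
    (hQ' : volume Q ≠ ⊤) (z : Space) :
    IntegrableOn (fun ξ => (𝐞 ⟪ξ, z⟫_ℝ : Circle) • w ξ) Q := by
  refine Measure.integrableOn_of_bounded (M := C) hQ' ?_ (ae_of_all _ fun ξ => ?_)
  · exact (measurable_fourierChar_smul hw (by fun_prop)).aestronglyMeasurable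
  · simpa only [norm_circle_smul] using hC ξ

/-- Adding the opposite phases cancels the imaginary part of the spinor overlap, on which there is
no control. -/
theorem re_inner_planeWave_add (v v' : Spin) (s t : ℝ) :
    (⟪(𝐞 s : Circle) • v, (𝐞 t : Circle) • v'⟫_ℂ).re
      + (⟪(𝐞 (-s) : Circle) • v, (𝐞 (-t) : Circle) • v'⟫_ℂ).re
      = 2 * Real.cos (2 * Real.pi * (t - s)) * (⟪v, v'⟫_ℂ).re := by
  have h (s t : ℝ) : ⟪(𝐞 s : Circle) • v, (𝐞 t : Circle) • v'⟫_ℂ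
      = ((𝐞 (t - s) : Circle) : ℂ) * ⟪v, v'⟫_ℂ := by
    rw [Circle.smul_def, Circle.smul_def, inner_smul_left, inner_smul_right, ← mul_assoc,
      ← Circle.coe_inv_eq_conj, ← Circle.coe_mul, ← AddChar.map_neg_eq_inv,
      ← AddChar.map_add_eq_mul, neg_add_eq_sub]
  rw [h, h, Real.fourierChar_apply, Real.fourierChar_apply, ← Complex.add_re, ← add_mul]
  have h2 : Complex.exp (↑(2 * Real.pi * (t - s)) * Complex.I)
      + Complex.exp (↑(2 * Real.pi * (-t - -s)) * Complex.I)
      = ((2 * Real.cos (2 * Real.pi * (t - s)) : ℝ) : ℂ) := by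
    push_cast
    rw [Complex.cos]
    ring_nf
  rw [h2, Complex.re_ofReal_mul]

variable {w' : Space → Spin} {C' : ℝ} {R : Set Space}

/-- Expanding both superpositions gives an integral over `Q × R` whose integrand is twice the cosine
times the real spinor overlap, hence at least `c₀`. -/
theorem le_re_inner_planeWaves_add (hw : Measurable w) (hC : ∀ ξ, ‖w ξ‖ ≤ C)
    (hQ : MeasurableSet Q) (hQ' : volume Q ≠ ⊤) (hw' : Measurable w') (hC' : ∀ ξ, ‖w' ξ‖ ≤ C')
    (hR : MeasurableSet R) (hR' : volume R ≠ ⊤) {c₀ : ℝ} (hc₀ : 0 ≤ c₀)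
    (h : ∀ ξ ∈ Q, ∀ η ∈ R, c₀ ≤ (⟪w ξ, w' η⟫_ℂ).re) {z : Space}
    (hz : ∀ ξ ∈ Q, ∀ η ∈ R, 1 / 2 ≤ Real.cos (2 * Real.pi * ⟪η - ξ, z⟫_ℝ)) :
    c₀ * volume.real R * volume.real Q ≤ (⟪planeWaves w Q z, planeWaves w' R z⟫_ℂ).re
      + (⟪planeWaves w Q (-z), planeWaves w' R (-z)⟫_ℂ).re := by
  have hright (v : Spin) (z : Space) : (⟪v, planeWaves w' R z⟫_ℂ).re
      = ∫ η in R, (⟪v, (𝐞 ⟪η, z⟫_ℝ : Circle) • w' η⟫_ℂ).re := by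
    have hi := integrableOn_planeWave hw' hC' hR' z
    rw [planeWaves, ← integral_inner (𝕜 := ℂ) hi]
    exact (integral_re (hi.const_inner (𝕜 := ℂ) v)).symm
  have hleft (v : Spin) (z : Space) : (⟪planeWaves w Q z, v⟫_ℂ).re
      = ∫ ξ in Q, (⟪(𝐞 ⟪ξ, z⟫_ℝ : Circle) • w ξ, v⟫_ℂ).re := by
    have hi := integrableOn_planeWave hw hC hQ' z
    have hs (u v : Spin) : (⟪u, v⟫_ℂ).re = (⟪v, u⟫_ℂ).re := inner_re_symm (𝕜 := ℂ) u v
    rw [hs, planeWaves, ← integral_inner (𝕜 := ℂ) hi]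
    simp only [hs _ v]
    exact (integral_re (hi.const_inner (𝕜 := ℂ) v)).symm
  have hli (v : Spin) (z : Space) :
      IntegrableOn (fun ξ => (⟪(𝐞 ⟪ξ, z⟫_ℝ : Circle) • w ξ, v⟫_ℂ).re) Q :=
    ((integrableOn_planeWave hw hC hQ' z).inner_const (𝕜 := ℂ) v).re
  have hri (v : Spin) (z : Space) :
      IntegrableOn (fun η => (⟪v, (𝐞 ⟪η, z⟫_ℝ : Circle) • w' η⟫_ℂ).re) R :=
    ((integrableOn_planeWave hw' hC' hR' z).const_inner (𝕜 := ℂ) v).re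
  rw [hleft, hleft, ← integral_add (hli _ _) (hli _ _)]
  refine setIntegral_ge_of_const_le_real hQ hQ' (fun ξ hξ => ?_) ((hli _ _).add (hli _ _))
  rw [hright, hright, ← integral_add (hri _ _) (hri _ _)]
  refine setIntegral_ge_of_const_le_real hR hR' (fun η hη => ?_) ((hri _ _).add (hri _ _))
  rw [inner_neg_right, inner_neg_right, re_inner_planeWave_add, ← inner_sub_left]
  nlinarith [h ξ hξ η hη, hz ξ hξ η hη]

theorem reflect_preimage_cube (x : Space) : (fun y => (x + x) - y) ⁻¹' cube x = cube x := by
  ext y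
  simp only [cube, Set.mem_preimage, Set.mem_ofPred_eq, Set.mem_Icc]
  refine forall_congr' fun i => ?_
  simp only [PiLp.sub_apply, PiLp.add_apply]
  constructor <;> rintro ⟨h1, h2⟩ <;> constructor <;> linarith

theorem volume_cube_ne_top (x : Space) : volume (cube x) ≠ ⊤ := by
  refine (Bornology.IsBounded.measure_lt_top ?_).ne
  refine (Metric.isBounded_closedBall (x := x) (r := 3 * Real.pi)).subset fun y hy => ?_
  rw [Metric.mem_closedBall, EuclideanSpace.dist_eq, Real.sqrt_le_left (by positivity),
    Fin.sum_univ_three]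
  have h (i : Fin 3) : dist (y i) (x i) ^ 2 ≤ Real.pi ^ 2 := by
    rw [Real.dist_eq, sq_abs]
    exact sq_le_sq' (hy i).1 (hy i).2
  nlinarith [h 0, h 1, h 2, sq_nonneg Real.pi]

/-- The cube is symmetric under the reflection y ↦ 2x - y, so the integrand may be averaged with its
reflection. This pairs the points `z` and `-z` of the previous bound, and the averaging is the
factor 1/2. -/
theorem le_norm_inner_packet (hw : Measurable w) (hC : ∀ ξ, ‖w ξ‖ ≤ C)
    (hQ : MeasurableSet Q) (hQ' : volume Q ≠ ⊤) (hw' : Measurable w') (hC' : ∀ ξ, ‖w' ξ‖ ≤ C')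
    (hR : MeasurableSet R) (hR' : volume R ≠ ⊤) {c₀ : ℝ} (hc₀ : 0 ≤ c₀)
    (h : ∀ ξ ∈ Q, ∀ η ∈ R, c₀ ≤ (⟪w ξ, w' η⟫_ℂ).re) (x : Space)
    (hz : ∀ ξ ∈ Q, ∀ η ∈ R, ∀ y ∈ cube x, 1 / 2 ≤ Real.cos (2 * Real.pi * ⟪η - ξ, y - x⟫_ℝ)) :
    c₀ * volume.real R * volume.real Q * volume.real (cube x) / 2
      ≤ ‖⟪packet hw hC x hQ hQ',
        (L2On (cube x)).starProjection (packet hw' hC' x hR hR')⟫_ℂ‖ := by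
  set e := packet hw hC x hQ hQ'
  set d := packet hw' hC' x hR hR'
  set G : Space → ℝ := fun y => (⟪e y, d y⟫_ℂ).re with hG
  have hGi : Integrable G := (L2.integrable_inner (𝕜 := ℂ) e d).re
  have hρ : MeasurePreserving (fun y : Space => (x + x) - y) volume volume :=
    Measure.measurePreserving_sub_left volume (x + x)
  have hρe : MeasurableEmbedding (fun y : Space => (x + x) - y) :=
    (MeasurableEquiv.subLeft (x + x)).measurableEmbedding
  have hint : ∫ y in cube x, G ((x + x) - y) = ∫ y in cube x, G y := by
    have := hρ.setIntegral_preimage_emb hρe G (cube x)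
    rwa [reflect_preimage_cube] at this
  have hGρ : Integrable fun y => G ((x + x) - y) := hρ.integrable_comp_of_integrable hGi
  have hae : ∀ᵐ y, G y + G ((x + x) - y)
      = (⟪planeWaves w Q (y - x), planeWaves w' R (y - x)⟫_ℂ).re
        + (⟪planeWaves w Q (-(y - x)), planeWaves w' R (-(y - x))⟫_ℂ).re := by
    have h1 := coeFn_packet hw hC x hQ hQ'
    have h2 := coeFn_packet hw' hC' x hR hR'
    filter_upwards [h1, h2, hρ.quasiMeasurePreserving.ae h1, hρ.quasiMeasurePreserving.ae h2]
      with y h3 h4 h5 h6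
    have h7 : x + x - y - x = -(y - x) := by abel
    rw [h7] at h5 h6
    simp only [hG]
    rw [h3, h4, h5, h6]
  have hsum : c₀ * volume.real R * volume.real Q * volume.real (cube x)
      ≤ ∫ y in cube x, (G y + G ((x + x) - y)) := by
    rw [integral_congr_ae (ae_restrict_of_ae hae)]
    refine setIntegral_ge_of_const_le_real (measurableSet_cube x) (volume_cube_ne_top x)
      (fun y hy => le_re_inner_planeWaves_add hw hC hQ hQ' hw' hC' hR hR' hc₀ h
        fun ξ hξ η hη => hz ξ hξ η hη y hy) ?_
    exact (hGi.add hGρ).integrableOn.congr (ae_restrict_of_ae hae)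
  rw [integral_add hGi.integrableOn hGρ.integrableOn, hint] at hsum
  rw [inner_starProjection_L2On (measurableSet_cube x)]
  refine le_trans ?_ (Complex.re_le_norm _)
  have hre : (∫ y in cube x, ⟪e y, d y⟫_ℂ).re = ∫ y in cube x, G y :=
    (integral_re (L2.integrable_inner (𝕜 := ℂ) e d).integrableOn).symm
  rw [hre]
  linarith

end Packet

/-! ### Spinors of positive and negative energy -/

/-- The relativistic energy at the momentum `2π ξ`. -/
def energy (m : ℝ) (ξ : Space) : ℝ :=
  √(m ^ 2 + (2 * Real.pi * ξ 0) ^ 2 + (2 * Real.pi * ξ 1) ^ 2 + (2 * Real.pi * ξ 2) ^ 2)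

theorem energy_sq (m : ℝ) (ξ : Space) : energy m ξ ^ 2
    = m ^ 2 + (2 * Real.pi * ξ 0) ^ 2 + (2 * Real.pi * ξ 1) ^ 2 + (2 * Real.pi * ξ 2) ^ 2 :=
  Real.sq_sqrt (by positivity)

theorem energy_nonneg (m : ℝ) (ξ : Space) : 0 ≤ energy m ξ := Real.sqrt_nonneg _

theorem continuous_energy (m : ℝ) : Continuous (energy m) := by
  unfold energy
  fun_prop

theorem momentum_le_energy (m : ℝ) (ξ : Space) : |2 * Real.pi * ξ 2| ≤ energy m ξ :=
  Real.abs_le_sqrt (le_add_of_nonneg_left (by positivity))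

theorem energy_pos (m : ℝ) {ξ : Space} (h : ξ 0 ≠ 0) : 0 < energy m ξ := by
  refine Real.sqrt_pos.mpr ?_
  have : 0 < (2 * Real.pi * ξ 0) ^ 2 := by
    have := Real.pi_ne_zero
    positivity
  positivity

theorem energy_le {m : ℝ} (hm : 0 ≤ m) (ξ : Space) :
    energy m ξ ≤ m + 2 * Real.pi * (|ξ 0| + |ξ 1| + |ξ 2|) := by
  have hπ := Real.pi_pos
  refine Real.sqrt_le_iff.mpr ⟨by positivity, ?_⟩
  have h0 := sq_abs (ξ 0)
  have h1 := sq_abs (ξ 1)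
  have h2 := sq_abs (ξ 2)
  have e : (2 * Real.pi * ξ 0) ^ 2 + (2 * Real.pi * ξ 1) ^ 2 + (2 * Real.pi * ξ 2) ^ 2
      = (2 * Real.pi * |ξ 0|) ^ 2 + (2 * Real.pi * |ξ 1|) ^ 2 + (2 * Real.pi * |ξ 2|) ^ 2 := by
    simp only [mul_pow, h0, h1, h2]
  have a0 : 0 ≤ 2 * Real.pi * |ξ 0| := by positivity
  have a1 : 0 ≤ 2 * Real.pi * |ξ 1| := by positivity
  have a2 : 0 ≤ 2 * Real.pi * |ξ 2| := by positivity
  nlinarith [mul_nonneg a0 a1, mul_nonneg a0 a2, mul_nonneg a1 a2, mul_nonneg hm a0,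
    mul_nonneg hm a1, mul_nonneg hm a2]

/-- A spinor of positive energy. -/
def spinorPlus (m : ℝ) (ξ : Space) : Spin :=
  ((energy m ξ)⁻¹ : ℂ) • !₂[(energy m ξ + 2 * Real.pi * ξ 2 + m : ℂ),
    (2 * Real.pi * ξ 0 + 2 * Real.pi * ξ 1 * Complex.I : ℂ),
    (energy m ξ + 2 * Real.pi * ξ 2 - m : ℂ),
    (2 * Real.pi * ξ 0 + 2 * Real.pi * ξ 1 * Complex.I : ℂ)]

/-- A spinor of negative energy. -/
def spinorMinus (m : ℝ) (ξ : Space) : Spin :=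
  ((energy m ξ)⁻¹ : ℂ) • !₂[(-(2 * Real.pi * ξ 0 - 2 * Real.pi * ξ 1 * Complex.I) : ℂ),
    (energy m ξ + 2 * Real.pi * ξ 2 - m : ℂ),
    (-(2 * Real.pi * ξ 0 - 2 * Real.pi * ξ 1 * Complex.I) : ℂ),
    (energy m ξ + 2 * Real.pi * ξ 2 + m : ℂ)]

theorem diracSymbol_eq (m : ℝ) (ξ : Space) : diracSymbol m ξ =
    !![(m : ℂ), 0, (2 * Real.pi * ξ 2 : ℂ), (2 * Real.pi * ξ 0 - 2 * Real.pi * ξ 1 * Complex.I : ℂ);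
      0, (m : ℂ), (2 * Real.pi * ξ 0 + 2 * Real.pi * ξ 1 * Complex.I : ℂ), -(2 * Real.pi * ξ 2 : ℂ);
      (2 * Real.pi * ξ 2 : ℂ), (2 * Real.pi * ξ 0 - 2 * Real.pi * ξ 1 * Complex.I : ℂ), -(m : ℂ), 0;
      (2 * Real.pi * ξ 0 + 2 * Real.pi * ξ 1 * Complex.I : ℂ), -(2 * Real.pi * ξ 2 : ℂ), 0,
        -(m : ℂ)] := by
  ext i j
  fin_cases i <;> fin_cases j <;>
    simp [diracSymbol, gamma, gamma0, Fin.sum_univ_three] <;> ring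

theorem energy_sq_complex (m : ℝ) (ξ : Space) : (energy m ξ : ℂ) ^ 2
    = m ^ 2 + (2 * Real.pi * ξ 0) ^ 2 + (2 * Real.pi * ξ 1) ^ 2 + (2 * Real.pi * ξ 2) ^ 2 := by
  exact_mod_cast congrArg Complex.ofReal (energy_sq m ξ)

theorem spinorPlus_mem {m : ℝ} {ξ : Space} (h : 0 < energy m ξ) :
    spinorPlus m ξ ∈ matrixSpectralSubspace (diracSymbol m ξ) (Set.Ioi 0) := by
  -- Up to the factor 1/E the spinor is (E + H)(1, 0, 1, 0), with H the symbol and H² = E², so its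
  -- eigenvalue is E.
  refine Submodule.mem_iSup_of_mem (energy m ξ) (Submodule.mem_iSup_of_mem h ?_)
  refine Submodule.smul_mem _ _ (Module.End.mem_eigenspace_iff.mpr ?_)
  have hE := energy_sq_complex m ξ
  have hI := Complex.I_sq
  rw [diracSymbol_eq]
  ext i
  fin_cases i <;> simp [Matrix.toLpLin_apply]
  · linear_combination -hE - (2 * Real.pi * ξ 1 : ℂ) ^ 2 * hI
  · ring
  · linear_combination -hE - (2 * Real.pi * ξ 1 : ℂ) ^ 2 * hI
  · ring

theorem spinorMinus_mem {m : ℝ} {ξ : Space} (h : 0 < energy m ξ) :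
    spinorMinus m ξ ∈ matrixSpectralSubspace (diracSymbol m ξ) (Set.Iio 0) := by
  -- Up to the factor 1/E the spinor is (E - H)(0, 1, 0, 1), so its eigenvalue is -E.
  refine Submodule.mem_iSup_of_mem (-energy m ξ)
    (Submodule.mem_iSup_of_mem (neg_lt_zero.mpr h) ?_)
  refine Submodule.smul_mem _ _ (Module.End.mem_eigenspace_iff.mpr ?_)
  have hE := energy_sq_complex m ξ
  have hI := Complex.I_sq
  rw [diracSymbol_eq]
  ext i
  fin_cases i <;> simp [Matrix.toLpLin_apply]
  · ring
  · linear_combination hE + (2 * Real.pi * ξ 1 : ℂ) ^ 2 * hI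
  · ring
  · linear_combination hE + (2 * Real.pi * ξ 1 : ℂ) ^ 2 * hI

theorem measurable_spinorPlus (m : ℝ) : Measurable (spinorPlus m) := by
  have hE := (continuous_energy m).measurable
  have hE' : Measurable fun ξ : Space => ((energy m ξ)⁻¹ : ℂ) := by fun_prop
  refine hE'.smul ?_
  refine (PiLp.continuous_toLp 2 _).measurable.comp (measurable_pi_iff.mpr fun i => ?_)
  fin_cases i <;> simp <;> fun_prop

theorem measurable_spinorMinus (m : ℝ) : Measurable (spinorMinus m) := by
  have hE := (continuous_energy m).measurable
  have hE' : Measurable fun ξ : Space => ((energy m ξ)⁻¹ : ℂ) := by fun_prop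
  refine hE'.smul ?_
  refine (PiLp.continuous_toLp 2 _).measurable.comp (measurable_pi_iff.mpr fun i => ?_)
  fin_cases i <;> simp <;> fun_prop

/-- As |2π ξ 2| ≤ E, the squared norm of `v` is at most 8 E², and 3 exceeds √8. At zero energy the
convention 0⁻¹ = 0 keeps the bound true. -/
theorem norm_inv_energy_smul_le {m : ℝ} {ξ : Space} {v : Spin}
    (hv : ‖v‖ ^ 2 = 4 * energy m ξ * (energy m ξ + 2 * Real.pi * ξ 2)) :
    ‖((energy m ξ)⁻¹ : ℂ) • v‖ ≤ 3 := by
  have hE := energy_nonneg m ξ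
  have hp := (abs_le.mp (momentum_le_energy m ξ)).2
  have h : ‖v‖ ≤ 3 * energy m ξ := by
    refine abs_le_of_sq_le_sq' ?_ (by positivity) |>.2
    rw [hv]
    nlinarith
  rw [norm_smul, norm_inv, Complex.norm_of_nonneg hE]
  exact (mul_le_mul_of_nonneg_left h (by positivity)).trans
    (by rw [mul_left_comm]; nlinarith [inv_mul_le_one (a := energy m ξ)])

theorem norm_spinorPlus_le (m : ℝ) (ξ : Space) : ‖spinorPlus m ξ‖ ≤ 3 := by
  refine norm_inv_energy_smul_le ?_
  rw [EuclideanSpace.norm_sq_eq, Fin.sum_univ_four]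
  simp only [← Complex.normSq_eq_norm_sq, Complex.normSq_apply]
  simp
  linear_combination -2 * energy_sq m ξ

theorem norm_spinorMinus_le (m : ℝ) (ξ : Space) : ‖spinorMinus m ξ‖ ≤ 3 := by
  refine norm_inv_energy_smul_le ?_
  rw [EuclideanSpace.norm_sq_eq, Fin.sum_univ_four]
  simp only [← Complex.normSq_eq_norm_sq, Complex.normSq_apply]
  simp
  linear_combination -2 * energy_sq m ξ

/-- The expression vanishes at ξ = η, as orthogonality demands. If ξ 0 > 0 > η 0 and ξ 2, η 2 ≥ 0,
both terms contribute positively, which dictates the choice of momentum cells. -/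
theorem re_inner_spinorPlus_spinorMinus (m : ℝ) (ξ η : Space) :
    (⟪spinorPlus m ξ, spinorMinus m η⟫_ℂ).re
      = 4 * Real.pi * (ξ 0 * (energy m η + 2 * Real.pi * η 2)
        - η 0 * (energy m ξ + 2 * Real.pi * ξ 2)) / (energy m ξ * energy m η) := by
  rw [spinorPlus, spinorMinus, inner_smul_left, inner_smul_right, PiLp.inner_apply,
    Fin.sum_univ_four]
  simp only [← Complex.ofReal_inv, Complex.conj_ofReal, Complex.re_ofReal_mul]
  simp
  ring

end DiracField

/-! ### Normalization of orthogonal families -/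

section Normalization

variable {V : Type*} [NormedAddCommGroup V] [InnerProductSpace ℂ V]

theorem orthonormal_inv_norm_smul {ι : Type*} {e : ι → V} (h0 : ∀ n, e n ≠ 0)
    (h : Pairwise fun i j => ⟪e i, e j⟫_ℂ = 0) :
    Orthonormal ℂ fun n => ((‖e n‖ : ℂ)⁻¹) • e n := by
  refine ⟨fun n => norm_smul_inv_norm (h0 n), fun i j hij => ?_⟩
  simp only [inner_smul_left, inner_smul_right, h hij, mul_zero]

/-- The positive lower bounds force the vectors to be nonzero, and normalizing divides each matrix
element by ‖e n‖ ‖d n‖ ≤ K. -/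
theorem exists_orthonormal_le_sum {X Y : Submodule ℂ V} (T : V →L[ℂ] V) {ι : Type}
    [Fintype ι] {e d : ι → V} {K : ℝ} (he : ∀ n, ‖e n‖ ^ 2 ≤ K) (hd : ∀ n, ‖d n‖ ^ 2 ≤ K)
    (hee : Pairwise fun i j => ⟪e i, e j⟫_ℂ = 0) (hdd : Pairwise fun i j => ⟪d i, d j⟫_ℂ = 0)
    (heX : ∀ n, e n ∈ X) (hdY : ∀ n, d n ∈ Y) {c : ι → ℝ} (hc : ∀ n, 0 < c n)
    (h : ∀ n, c n ≤ ‖⟪e n, T (d n)⟫_ℂ‖) :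
    ∃ e' d' : ι → V, Orthonormal ℂ e' ∧ Orthonormal ℂ d' ∧ (∀ n, e' n ∈ X) ∧ (∀ n, d' n ∈ Y) ∧
      ∑ n, (c n / K) ^ 2 ≤ ∑ n, ‖⟪e' n, T (d' n)⟫_ℂ‖ ^ 2 := by
  have he0 n : e n ≠ 0 := fun h0 => by
    have := (hc n).trans_le (h n)
    simp [h0] at this
  have hd0 n : d n ≠ 0 := fun h0 => by
    have := (hc n).trans_le (h n)
    simp [h0] at this
  refine ⟨_, _, orthonormal_inv_norm_smul he0 hee, orthonormal_inv_norm_smul hd0 hdd,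
    fun n => X.smul_mem _ (heX n), fun n => Y.smul_mem _ (hdY n), ?_⟩
  refine Finset.sum_le_sum fun n _ => ?_
  have h1 : 0 < ‖e n‖ := norm_pos_iff.mpr (he0 n)
  have h2 : 0 < ‖d n‖ := norm_pos_iff.mpr (hd0 n)
  have h3 : ‖e n‖ * ‖d n‖ ≤ K := by nlinarith [he n, hd n, sq_nonneg (‖e n‖ - ‖d n‖)]
  have h4 : ‖⟪((‖e n‖ : ℂ)⁻¹) • e n, T (((‖d n‖ : ℂ)⁻¹) • d n)⟫_ℂ‖
      = ‖⟪e n, T (d n)⟫_ℂ‖ / (‖e n‖ * ‖d n‖) := by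
    rw [map_smul, inner_smul_left, inner_smul_right, norm_mul, norm_mul]
    simp
    field_simp
  have hK : 0 < K := (mul_pos h1 h2).trans_le h3
  have hcn := hc n
  rw [h4]
  refine pow_le_pow_left₀ (by positivity) ?_ 2
  exact div_le_div₀ (norm_nonneg _) (h n) (mul_pos h1 h2) h3

end Normalization

/-! ### Momentum cells and divergence of the Hilbert-Schmidt sum -/

namespace DiracField

/-- The cube with side `1 / 200` and lowest corner `a` in momentum space. -/
def momentumCell (a : Fin 3 → ℝ) : Set Space := {ξ | ∀ j, ξ j ∈ Set.Ico (a j) (a j + 1 / 200)}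

theorem momentumCell_eq (a : Fin 3 → ℝ) : momentumCell a
    = (WithLp.ofLp : Space → Fin 3 → ℝ) ⁻¹' Set.univ.pi fun j => Set.Ico (a j) (a j + 1 / 200) := by
  ext ξ
  simp [momentumCell]

theorem measurableSet_momentumCell (a : Fin 3 → ℝ) : MeasurableSet (momentumCell a) := by
  rw [momentumCell_eq]
  exact (MeasurableSet.univ_pi fun _ => measurableSet_Ico).preimage (by fun_prop)

theorem volume_momentumCell (a : Fin 3 → ℝ) :
    volume (momentumCell a) = ENNReal.ofReal ((1 / 200) ^ 3) := by
  rw [momentumCell_eq, (PiLp.volume_preserving_ofLp (Fin 3)).measure_preimage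
    (MeasurableSet.univ_pi fun _ => measurableSet_Ico).nullMeasurableSet, Real.volume_pi_Ico]
  simp only [add_sub_cancel_left, Finset.prod_const, Finset.card_univ, Fintype.card_fin]
  rw [ENNReal.ofReal_pow (by norm_num)]

theorem volume_momentumCell_ne_top (a : Fin 3 → ℝ) : volume (momentumCell a) ≠ ⊤ := by
  rw [volume_momentumCell]
  exact ENNReal.ofReal_ne_top

theorem volume_real_momentumCell (a : Fin 3 → ℝ) :
    volume.real (momentumCell a) = (1 / 200) ^ 3 := by
  rw [Measure.real, volume_momentumCell, ENNReal.toReal_ofReal (by positivity)]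

theorem disjoint_momentumCell {s : ℝ} {i k i' k' : ℕ} (h : (i, k) ≠ (i', k')) :
    Disjoint (momentumCell ![s, i / 200, k / 200]) (momentumCell ![s, i' / 200, k' / 200]) := by
  refine Set.disjoint_left.mpr fun ξ hξ hξ' => h ?_
  have key {p q : ℕ} {r : ℝ} (h1 : r ∈ Set.Ico (p / 200 : ℝ) (p / 200 + 1 / 200))
      (h2 : r ∈ Set.Ico (q / 200 : ℝ) (q / 200 + 1 / 200)) : p = q := by
    have h3 : (p : ℝ) < q + 1 := by linarith [h1.1, h2.2]
    have h4 : (q : ℝ) < p + 1 := by linarith [h1.2, h2.1]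
    have h5 : p < q + 1 := by exact_mod_cast h3
    have h6 : q < p + 1 := by exact_mod_cast h4
    omega
  exact Prod.ext (key (hξ 1) (hξ' 1)) (key (hξ 2) (hξ' 2))

theorem mem_momentumCell {s : ℝ} {i k : ℕ} {ξ : Space}
    (h : ξ ∈ momentumCell ![s, i / 200, k / 200]) :
    (s ≤ ξ 0 ∧ ξ 0 < s + 1 / 200) ∧ ((i : ℝ) / 200 ≤ ξ 1 ∧ ξ 1 < i / 200 + 1 / 200) ∧
      ((k : ℝ) / 200 ≤ ξ 2 ∧ ξ 2 < k / 200 + 1 / 200) :=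
  ⟨h 0, h 1, h 2⟩

theorem energy_le_of_mem_momentumCell {m : ℝ} (hm : 0 ≤ m) {s : ℝ} (hs : -(1 / 100) ≤ s)
    (hs' : s ≤ 1 / 200) {i k : ℕ} (hik : i ≤ k) {ξ : Space}
    (h : ξ ∈ momentumCell ![s, i / 200, k / 200]) : energy m ξ ≤ (m + 1) * (k + 1) := by
  obtain ⟨⟨h1, h2⟩, ⟨h3, h4⟩, ⟨h5, h6⟩⟩ := mem_momentumCell h
  have hi : (i : ℝ) ≤ k := by exact_mod_cast hik
  have hi0 : (0 : ℝ) ≤ i := i.cast_nonneg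
  have hk0 : (0 : ℝ) ≤ k := k.cast_nonneg
  have e0 : |ξ 0| ≤ 1 / 100 := abs_le.mpr ⟨by linarith, by linarith⟩
  have e1 : |ξ 1| = ξ 1 := abs_of_nonneg (by linarith)
  have e2 : |ξ 2| = ξ 2 := abs_of_nonneg (by linarith)
  refine (energy_le hm ξ).trans ?_
  have e3 : |ξ 0| + |ξ 1| + |ξ 2| ≤ (k + 1) / 50 := by
    rw [e1, e2]
    linarith
  have e4 := mul_le_mul_of_nonneg_left e3 (by positivity : 0 ≤ 2 * Real.pi)
  have e5 : 2 * Real.pi * ((k + 1) / 50) ≤ k + 1 := by nlinarith [Real.pi_le_four]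
  nlinarith [mul_nonneg hm hk0]

/-- The cells keep ξ 0 ≥ 1/200 and η 0 < 0, so the numerator is at least of the order of the energy
at η. What is left is the inverse of the energy at ξ, which grows at most linearly in `k`. -/
theorem le_re_inner_spinor {m : ℝ} (hm : 0 ≤ m) {i k : ℕ} (hik : i ≤ k) {ξ η : Space}
    (hξ : ξ ∈ momentumCell ![1 / 200, i / 200, k / 200])
    (hη : η ∈ momentumCell ![-(1 / 100), i / 200, k / 200]) :
    1 / (200 * (m + 1) * (k + 1)) ≤ (⟪spinorPlus m ξ, spinorMinus m η⟫_ℂ).re := by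
  have hE := energy_le_of_mem_momentumCell hm (by norm_num) le_rfl hik hξ
  obtain ⟨⟨h1, -⟩, -, ⟨h5, -⟩⟩ := mem_momentumCell hξ
  obtain ⟨⟨-, h8⟩, -, ⟨h11, -⟩⟩ := mem_momentumCell hη
  have hk0 : (0 : ℝ) ≤ (k : ℝ) / 200 := by positivity
  have p1 : 0 < energy m ξ := energy_pos m (by intro h; linarith)
  have p2 : 0 < energy m η := energy_pos m (by intro h; linarith)
  have hπ := Real.pi_gt_three
  rw [re_inner_spinorPlus_spinorMinus]
  have a1 : 1 / 200 * energy m η ≤ ξ 0 * (energy m η + 2 * Real.pi * η 2) := by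
    have : 0 ≤ 2 * Real.pi * η 2 := mul_nonneg (by positivity) (hk0.trans h11)
    nlinarith
  have a2 : 0 ≤ -η 0 * (energy m ξ + 2 * Real.pi * ξ 2) :=
    mul_nonneg (by linarith) (add_nonneg p1.le (mul_nonneg (by positivity) (hk0.trans h5)))
  have a3 : 1 / 200 * energy m η ≤ 4 * Real.pi * (ξ 0 * (energy m η + 2 * Real.pi * η 2)
      - η 0 * (energy m ξ + 2 * Real.pi * ξ 2)) := by nlinarith
  calc 1 / (200 * (m + 1) * (k + 1)) = 1 / 200 / ((m + 1) * (k + 1)) := by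
        rw [div_div]; ring_nf
    _ ≤ 1 / 200 / energy m ξ := div_le_div_of_nonneg_left (by norm_num) p1 hE
    _ = 1 / 200 * energy m η / (energy m ξ * energy m η) := by field_simp
    _ ≤ _ := by gcongr

theorem half_le_cos_of_mem_momentumCell {i k : ℕ} {ξ η x y : Space}
    (hξ : ξ ∈ momentumCell ![1 / 200, i / 200, k / 200])
    (hη : η ∈ momentumCell ![-(1 / 100), i / 200, k / 200]) (hy : y ∈ cube x) :
    1 / 2 ≤ Real.cos (2 * Real.pi * ⟪η - ξ, y - x⟫_ℝ) := by
  obtain ⟨⟨h1, h2⟩, ⟨h3, h4⟩, ⟨h5, h6⟩⟩ := mem_momentumCell hξ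
  obtain ⟨⟨h7, h8⟩, ⟨h9, h10⟩, ⟨h11, h12⟩⟩ := mem_momentumCell hη
  have hb (j : Fin 3) (C : ℝ) (hC : |η j - ξ j| ≤ C) :
      |(η j - ξ j) * (y j - x j)| ≤ C * Real.pi := by
    rw [abs_mul]
    exact mul_le_mul hC (abs_le.mpr (hy j)) (abs_nonneg _) ((abs_nonneg _).trans hC)
  -- In the direction 0 the cells are [1/200, 2/200) and [-2/200, -1/200), at most 4/200 apart; in
  -- the other directions they coincide. The phase is then at most 12π²/200 < 1, and the cosine is
  -- at least 1 - 1/2.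
  have b0 := hb 0 (4 / 200) (abs_le.mpr ⟨by linarith, by linarith⟩)
  have b1 := hb 1 (1 / 200) (abs_le.mpr ⟨by linarith, by linarith⟩)
  have b2 := hb 2 (1 / 200) (abs_le.mpr ⟨by linarith, by linarith⟩)
  have hin : ⟪η - ξ, y - x⟫_ℝ = (η 0 - ξ 0) * (y 0 - x 0) + (η 1 - ξ 1) * (y 1 - x 1)
      + (η 2 - ξ 2) * (y 2 - x 2) := by
    rw [PiLp.inner_apply, Fin.sum_univ_three]
    simp
    ring
  have b3 : |⟪η - ξ, y - x⟫_ℝ| ≤ 6 / 200 * Real.pi := by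
    rw [hin]
    refine (abs_add_three _ _ _).trans ?_
    linarith
  have b4 : |2 * Real.pi * ⟪η - ξ, y - x⟫_ℝ| ≤ 1 := by
    rw [abs_mul, abs_of_pos Real.two_pi_pos]
    nlinarith [Real.pi_lt_d2, Real.pi_pos]
  have b5 := Real.one_sub_sq_div_two_le_cos (x := 2 * Real.pi * ⟪η - ξ, y - x⟫_ℝ)
  have b6 := (sq_le_one_iff_abs_le_one _).mpr b4
  linarith

theorem volume_real_cube_pos (x : Space) : 0 < volume.real (cube x) := by
  refine ENNReal.toReal_pos (ne_of_gt ?_) (volume_cube_ne_top x)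
  refine (Metric.measure_ball_pos volume x one_pos).trans_le (measure_mono fun y hy i => ?_)
  rw [Metric.mem_ball, dist_eq_norm] at hy
  have h := (PiLp.norm_apply_le (y - x) i).trans hy.le
  rw [PiLp.sub_apply, Real.norm_eq_abs, abs_le] at h
  have := Real.pi_gt_three
  constructor <;> linarith [h.1, h.2]

/-- The compression from `h₋` to `h₊` of the projection onto the functions on a cube is not a
Hilbert-Schmidt operator. -/
theorem exists_packets_lt_sum {m : ℝ} (hm : 0 ≤ m) (x : Space) (R : ℝ) :
    ∃ (ι : Type) (_ : Fintype ι) (e d : ι → OneParticle), Orthonormal ℂ e ∧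
      Orthonormal ℂ d ∧ (∀ n, e n ∈ hPlus m) ∧ (∀ n, d n ∈ hMinus m) ∧
      R < ∑ n, ‖⟪e n, (L2On (cube x)).starProjection (d n)⟫_ℂ‖ ^ 2 := by
  -- Chosen so that the normalized matrix element at height `k` is at least `a / (k + 1)`.
  set a : ℝ := (1 / 200) ^ 3 * (1 / 200) ^ 3 * volume.real (cube x) / 2 / (200 * (m + 1)) /
    (3 ^ 2 * (1 / 200) ^ 3) with ha
  have hvol := volume_real_cube_pos x
  have ha0 : 0 < a := by positivity
  obtain ⟨N, hN⟩ := ((Real.tendsto_sum_range_one_div_nat_succ_atTop).eventually_gt_atTop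
    (R / a ^ 2)).exists
  -- The pairs (i, k) with i ≤ k < N. The restriction i ≤ k keeps the energy of order `k + 1` and
  -- leaves `k + 1` cells at height `k`.
  let idx : (Σ k : Fin N, Fin (k + 1)) → ℕ × ℕ := fun n => (n.2, n.1)
  have hidx : Function.Injective idx := by
    rintro ⟨k, i⟩ ⟨k', i'⟩ h
    obtain ⟨h1, h2⟩ := Prod.mk.injEq .. ▸ h
    obtain rfl : k = k' := Fin.ext h2
    obtain rfl : i = i' := Fin.ext h1
    rfl
  let cell (s : ℝ) (n : Σ k : Fin N, Fin (k + 1)) : Set Space :=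
    momentumCell ![s, (idx n).1 / 200, (idx n).2 / 200]
  have hcell (s n) : MeasurableSet (cell s n) := measurableSet_momentumCell _
  have hcell' (s n) : volume (cell s n) ≠ ⊤ := volume_momentumCell_ne_top _
  have hvcell (s n) : volume.real (cell s n) = (1 / 200) ^ 3 := volume_real_momentumCell _
  have hdisj (s) {n n'} (h : n ≠ n') : Disjoint (cell s n) (cell s n') :=
    disjoint_momentumCell (hidx.ne h)
  have hle (n : Σ k : Fin N, Fin (k + 1)) : (idx n).1 ≤ (idx n).2 := Nat.lt_succ_iff.mp n.2.2
  let e (n : Σ k : Fin N, Fin (k + 1)) : OneParticle := packet (measurable_spinorPlus m)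
    (norm_spinorPlus_le m) x (hcell (1 / 200) n) (hcell' _ n)
  let d (n : Σ k : Fin N, Fin (k + 1)) : OneParticle := packet (measurable_spinorMinus m)
    (norm_spinorMinus_le m) x (hcell (-(1 / 100)) n) (hcell' _ n)
  obtain ⟨e', d', he', hd', heX, hdY, hsum⟩ := exists_orthonormal_le_sum (X := hPlus m)
    (Y := hMinus m) (L2On (cube x)).starProjection (e := e) (d := d)
    (K := 3 ^ 2 * (1 / 200) ^ 3)
    (c := fun n => 1 / (200 * (m + 1) * ((idx n).2 + 1)) * (1 / 200) ^ 3 * (1 / 200) ^ 3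
      * volume.real (cube x) / 2)
    (fun n => (norm_packet_sq_le _ _ _ _ _).trans_eq (by rw [hvcell]))
    (fun n => (norm_packet_sq_le _ _ _ _ _).trans_eq (by rw [hvcell]))
    (fun n n' h => inner_packet_eq_zero _ _ _ _ _ _ _ (hdisj _ h))
    (fun n n' h => inner_packet_eq_zero _ _ _ _ _ _ _ (hdisj _ h))
    (fun n => packet_mem_spectralSubspace _ _ _ _ _ fun ξ hξ => spinorPlus_mem <|
      energy_pos m fun h => by linarith [(mem_momentumCell hξ).1.1])
    (fun n => packet_mem_spectralSubspace _ _ _ _ _ fun ξ hξ => spinorMinus_mem <|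
      energy_pos m fun h => by linarith [(mem_momentumCell hξ).1.2])
    (fun n => by positivity)
    (fun n => by
      have h := le_norm_inner_packet (measurable_spinorPlus m) (norm_spinorPlus_le m)
        (hcell (1 / 200) n) (hcell' _ n) (measurable_spinorMinus m) (norm_spinorMinus_le m)
        (hcell (-(1 / 100)) n) (hcell' _ n)
        (by positivity) (fun ξ hξ η hη => le_re_inner_spinor hm (hle n) hξ hη) x
        (fun ξ hξ η hη y hy => half_le_cos_of_mem_momentumCell hξ hη hy)
      rwa [hvcell, hvcell] at h)
  refine ⟨_, inferInstance, e', d', he', hd', heX, hdY, lt_of_lt_of_le ?_ hsum⟩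
  -- Height `k` contributes `(k + 1) * (a / (k + 1)) ^ 2`, a term of the harmonic series.
  have hval : ∑ n : (Σ k : Fin N, Fin (k + 1)), (1 / (200 * (m + 1) * ((idx n).2 + 1))
      * (1 / 200) ^ 3 * (1 / 200) ^ 3 * volume.real (cube x) / 2 / (3 ^ 2 * (1 / 200) ^ 3)) ^ 2
      = a ^ 2 * ∑ k ∈ Finset.range N, 1 / ((k : ℝ) + 1) := by
    rw [Fintype.sum_sigma, ← Fin.sum_univ_eq_sum_range (fun k => 1 / ((k : ℝ) + 1)),
      Finset.mul_sum]
    refine Finset.sum_congr rfl fun k _ => ?_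
    simp only [idx, Finset.sum_const, Finset.card_univ, Fintype.card_fin, nsmul_eq_mul]
    rw [ha]
    push_cast
    field_simp
  rw [hval, ← div_lt_iff₀' (by positivity)]
  exact hN

end DiracField

end

theorem theorem1 (m : ℝ) (hm : 0 ≤ m) (ψ : DiracField.FockSpace m)
    (hψ : ψ ∈ DiracField.polynomialStates m) (hψ0 : ψ ≠ 0) (x : DiracField.Space) :
    ∃ f : HilbertBasis ℕ ℂ (DiracField.L2On (DiracField.cube x)),
      Tendsto (fun J : ℕ =>
        ‖DiracField.truncatedCharge m (fun j => (f j : DiracField.OneParticle)) J ψ‖ ^ 2)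
        atTop atTop ∧
      ψ ∉ DiracField.chargeDomain m (fun j => (f j : DiracField.OneParticle)) :=
  DiracField.exists_hilbertBasis_tendsto hψ hψ0 _ (DiracField.exists_packets_lt_sum hm x)
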